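/- Let $d\in\mathbb N\cup\{\infty\}$ and let $\mathbb B_d$ be the open unit ball of a complex Hilbert space of dimension $d$ ($\ell^2$ if $d=\infty$), with orthonormal basis $(e_i)$. The Drury–Arveson space $H^2_d$ is the reproducing kernel Hilbert space (RKHS) on $\mathbb B_d$ with kernel $k(z,w)=k_w(z)=\frac1{1-\langle z,w\rangle}$. For $X\subseteq\mathbb B_d$, let $\mathcal H_X=\overline{\operatorname{span}}\{k_x:x\in X\}\subseteq H^2_d$, regarded as an RKHS of functions on $X$, and let $\mathcal M_X=\operatorname{Mult}(\mathcal H_X)$ be its algebra of multipliers, normed (as are the matrices over it) by the multiplication operators $M_f:h\mapsto fh$. **Distances.** * The pseudohyperbolic metric is $\rho_{\mathrm{ph}}(z,w)=\|\Psi_w(z)\|$, where $\Psi_w(z)=\frac{w-P_wz-(1-\|w\|^2)^{1/2}(I-P_w)z}{1-\langle z,w\rangle}$ and $P_w$ is the orthogonal projection onto $\mathbb Cw$. For $n$-point sets $X,Y\subseteq\mathbb B_d$ put $\rho_s(X,Y)=\min_{\sigma}\max_{x\in X}\rho_{\mathrm{ph}}(x,\sigma(x))$, the minimum over all bijections $\sigma:X\to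 Y$, and $\tilde\rho_s(X,Y)=\inf_{\Phi}\rho_s(X,\Phi(Y))$, the infimum over all biholomorphic automorphisms $\Phi$ of $\mathbb B_d$. * An RKHS isomorphism $T:\mathcal H_X\to\mathcal H_Y$ is a bounded bijective linear map such that $Tk_x=\lambda_xk_{F(x)}$ for all $x\in X$, for some bijection $F:X\to Y$ and some scalars $\lambda_x\neq0$. Put $\rho_{RK}(\mathcal H_X,\mathcal H_Y)=\log\inf_T\|T\|\,\|T^{-1}\|$, the infimum over all RKHS isomorphisms. * A multiplier algebra isomorphism $\varphi:\mathcal M_X\to\mathcal M_Y$ is an algebra isomorphism such that $\varphi$ and $\varphi^{-1}$ are completely bounded and $\varphi(f)=f\circ G$ for some bijection $G:Y\to X$. Put $\rho_M(\mathcal M_X,\mathcal M_Y)=\log\inf_\varphi\|\varphi\|_{cb}\|\varphi^{-1}\|_{cb}$, the infimum over all multiplier algebra isomorphisms. * For $F=\sum_iF_ie_i$, a function on $\mathbb B_d$ with values in the $d$-dimensional Hilbert space, let $\|F\|$ be the norm of the row operator $M_F:\bigoplus_iH^2_d\to H^2_d$, $(h_i)_i\mapsto\sum_iF_ih_i$;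 $F$ is called a multiplier if this operator is defined and bounded. Put $\delta_{mult}(X,Y)=\inf\max\{\|F\|,\|G\|\}$, the infimum over all such multipliers $F,G$ for which $F|_X$ is a bijection of $X$ onto $Y$ and $G|_Y=(F|_X)^{-1}$. **Theorem.** Let $n\ge2$, let $X\subset\mathbb B_d$ be a set of $n$ points, and let $(Y^{(k)})_k$ be a sequence of $n$-point subsets of $\mathbb B_d$. The following are equivalent as $k\to\infty$: 1. $\tilde\rho_s(X,Y^{(k)})\to0$; 2. $\rho_{RK}(\mathcal H_X,\mathcal H_{Y^{(k)}})\to0$; 3. $\rho_M(\mathcal M_X,\mathcal M_{Y^{(k)}})\to0$; 4. $\inf\{\|\varphi\|_{cb}\|\varphi^{-1}\|_{cb}:\varphi:\mathcal M_X\to\mathcal M_{Y^{(k)}}\text{ an algebra isomorphism}\}\to1$. Moreover, if (3) holds, then $\delta_{mult}(X,Y^{(k)})\to1$. -/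

import Mathlib

open Filter Topology
open scoped ENNReal

noncomputable section

/-! ### The unit ball, the pseudohyperbolic metric and symmetric distances -/

/-- The complex Hilbert space `ℓ²(ι)`; its dimension `d` is the cardinality of `ι`. -/
abbrev HilbertCd (ι : Type*) : Type _ := lp (fun _ : ι => ℂ) 2

/-- The open unit ball `𝔹_d` of `ℓ²(ι)`. -/
abbrev UnitBall (ι : Type*) : Type _ := ↥(Metric.ball (0 : HilbertCd ι) 1)

/-- The elementary automorphism
`Ψ_w(z) = (w - P_w z - (1 - ‖w‖²)^{1/2} P_w^⊥ z) / (1 - ⟨z, w⟩)`, where `P_w` is the orthogonal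
projection onto the span of `w`. (Mathlib's inner product is linear in the second variable, so
that `⟨z, w⟩` is `inner ℂ w z`.) -/
def elemAut {ι : Type*} (w z : HilbertCd ι) : HilbertCd ι :=
  (1 - inner ℂ w z)⁻¹ •
    (w - (Submodule.span ℂ {w}).starProjection z
      - (Real.sqrt (1 - ‖w‖ ^ 2) : ℂ) • (z - (Submodule.span ℂ {w}).starProjection z))

/-- The pseudohyperbolic metric on the ball. -/
def rhoPh {ι : Type*} (z w : UnitBall ι) : ℝ := ‖elemAut (w : HilbertCd ι) (z : HilbertCd ι)‖

/-- The symmetric distance between two finite subsets of the ball with the same (nonzero)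
cardinality, induced by the pseudohyperbolic metric: the minimum over all bijections `σ : X → Y`
of `max_x ρ_ph(x, σ x)`. -/
def rhoS {ι : Type*} (X Y : Set (UnitBall ι)) : ℝ :=
  ⨅ σ : X ≃ Y, ⨆ x : X, rhoPh (x : UnitBall ι) (σ x : UnitBall ι)

/-- A bijection of the ball is a biholomorphic automorphism if it and its inverse are holomorphic,
that is, restrictions to the ball of functions that are complex differentiable on the ball. -/
def IsBiholomorphic {ι : Type*} (Φ : UnitBall ι ≃ UnitBall ι) : Prop :=
  (∃ f : HilbertCd ι → HilbertCd ι, DifferentiableOn ℂ f (Metric.ball 0 1) ∧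
    ∀ z : UnitBall ι, f z = Φ z) ∧
  (∃ g : HilbertCd ι → HilbertCd ι, DifferentiableOn ℂ g (Metric.ball 0 1) ∧
    ∀ z : UnitBall ι, g z = Φ.symm z)

/-- The automorphism invariant symmetric distance. -/
def rhoSInv {ι : Type*} (X Y : Set (UnitBall ι)) : ℝ :=
  ⨅ Φ : {Φ : UnitBall ι ≃ UnitBall ι // IsBiholomorphic Φ}, rhoS X (Φ.1 '' Y)

/-! ### Scalar reproducing kernel Hilbert spaces: isomorphisms and multipliers -/

section RKHSNotions

/-- The reproducing kernel `k_x` at a point `x`. -/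
def kerAt {X : Type*} (H : Type*) [NormedAddCommGroup H] [InnerProductSpace ℂ H] [CompleteSpace H]
    [RKHS ℂ H X ℂ] (x : X) : H :=
  RKHS.kerFun H x (1 : ℂ)

variable {X₁ X₂ : Type*} {H₁ H₂ : Type*}
  [NormedAddCommGroup H₁] [InnerProductSpace ℂ H₁] [RKHS ℂ H₁ X₁ ℂ]
  [NormedAddCommGroup H₂] [InnerProductSpace ℂ H₂] [RKHS ℂ H₂ X₂ ℂ]

/-- An RKHS isomorphism: a bounded bijective linear map (with bounded inverse) of the form
`T k_x = λ_x k_{F x}`, with `F` a bijection and `λ` nowhere vanishing. -/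
def IsRKHSIso [CompleteSpace H₁] [CompleteSpace H₂] (T : H₁ ≃L[ℂ] H₂) : Prop :=
  ∃ (F : X₁ ≃ X₂) (c : X₁ → ℂ), (∀ x, c x ≠ 0) ∧
    ∀ x, T (kerAt H₁ x) = c x • kerAt H₂ (F x)

variable (H₁ H₂) in
/-- The infimum of `‖T‖ ‖T⁻¹‖` over all RKHS isomorphisms (`∞` if there are none). -/
def deltaRK [CompleteSpace H₁] [CompleteSpace H₂] : ℝ≥0∞ :=
  ⨅ (T : H₁ ≃L[ℂ] H₂) (_ : IsRKHSIso T), ‖(T : H₁ →L[ℂ] H₂)‖ₑ * ‖(T.symm : H₂ →L[ℂ] H₁)‖ₑ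

variable (H₁ H₂) in
/-- The reproducing kernel Banach-Mazur distance (`∞` if there is no RKHS isomorphism). -/
def rhoRK [CompleteSpace H₁] [CompleteSpace H₂] : EReal := ENNReal.log (deltaRK H₁ H₂)

/-- The multiplier algebra of an RKHS `H` on `X`: all functions `f` on `X` for which
`h ↦ f h` is a (bounded) operator on `H`. -/
def MultAlg {X : Type*} (H : Type*) [NormedAddCommGroup H] [InnerProductSpace ℂ H]
    [RKHS ℂ H X ℂ] : Subalgebra ℂ (X → ℂ) where
  carrier := {f | ∃ M : H →L[ℂ] H, ∀ (h : H) (x : X), M h x = f x * h x}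
  mul_mem' := by
    rintro f g ⟨M, hM⟩ ⟨N, hN⟩
    exact ⟨M ∘L N, fun h x => by simp [hM, hN, mul_assoc]⟩
  add_mem' := by
    rintro f g ⟨M, hM⟩ ⟨N, hN⟩
    exact ⟨M + N, fun h x => by simp [hM, hN, add_mul]⟩
  algebraMap_mem' := fun c => ⟨c • ContinuousLinearMap.id ℂ H, fun h x => by simp⟩

/-- The multiplication operator `M_f` of a multiplier `f`. -/
def multOp {X : Type*} {H : Type*} [NormedAddCommGroup H] [InnerProductSpace ℂ H]
    [RKHS ℂ H X ℂ] (f : MultAlg H) : H →L[ℂ] H :=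
  Classical.choose f.2

theorem multOp_apply {X : Type*} {H : Type*} [NormedAddCommGroup H] [InnerProductSpace ℂ H]
    [RKHS ℂ H X ℂ] (f : MultAlg H) (h : H) (x : X) : multOp f h x = f.1 x * h x :=
  Classical.choose_spec f.2 h x

/-- The operator on the Hilbert space direct sum `H ⊕ ⋯ ⊕ H` (`m` summands) given by an
`m × m` matrix of operators on `H`. -/
def opMatrix {H : Type*} [NormedAddCommGroup H] [InnerProductSpace ℂ H] {m : ℕ}
    (A : Matrix (Fin m) (Fin m) (H →L[ℂ] H)) :
    PiLp 2 (fun _ : Fin m => H) →L[ℂ] PiLp 2 (fun _ : Fin m => H) :=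
  ((PiLp.continuousLinearEquiv 2 ℂ (fun _ : Fin m => H)).symm :
      (Fin m → H) →L[ℂ] PiLp 2 (fun _ : Fin m => H)) ∘L
    ContinuousLinearMap.pi (fun i => ∑ j, A i j ∘L PiLp.proj 2 (fun _ : Fin m => H) j)

/-- The norm of an `m × m` matrix of multipliers, as an operator on the direct sum of `m` copies
of `H`. -/
def multMatrixNorm {X : Type*} {H : Type*} [NormedAddCommGroup H] [InnerProductSpace ℂ H]
    [RKHS ℂ H X ℂ] {m : ℕ} (A : Matrix (Fin m) (Fin m) (MultAlg H)) : ℝ≥0∞ :=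
  ‖opMatrix (A.map multOp)‖ₑ

/-- The completely bounded norm of a linear map between multiplier algebras: the supremum over
`m` of the norms of the entrywise maps between the algebras of `m × m` matrices. -/
def cbNorm (φ : MultAlg H₁ →ₗ[ℂ] MultAlg H₂) : ℝ≥0∞ :=
  ⨆ (m : ℕ) (A : Matrix (Fin m) (Fin m) (MultAlg H₁)) (_ : multMatrixNorm A ≤ 1),
    multMatrixNorm (A.map φ)

/-- The quantity `‖φ‖_cb ‖φ⁻¹‖_cb` of an algebra isomorphism of multiplier algebras. -/
def cbDistortion (φ : MultAlg H₁ ≃ₐ[ℂ] MultAlg H₂) : ℝ≥0∞ :=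
  cbNorm φ.toLinearMap * cbNorm φ.symm.toLinearMap

/-- A multiplier algebra isomorphism: a completely bounded algebra isomorphism with completely
bounded inverse which is the composition with a bijection of the underlying sets. -/
def IsMultIso (φ : MultAlg H₁ ≃ₐ[ℂ] MultAlg H₂) : Prop :=
  cbNorm φ.toLinearMap < ∞ ∧ cbNorm φ.symm.toLinearMap < ∞ ∧
    ∃ G : X₂ ≃ X₁, ∀ (f : MultAlg H₁) (y : X₂), (φ f).1 y = f.1 (G y)

variable (H₁ H₂) in
/-- The infimum of `‖φ‖_cb ‖φ⁻¹‖_cb` over all multiplier algebra isomorphisms between the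
multiplier algebras of `H₁` and `H₂` (`∞` if there are none). -/
def deltaM : ℝ≥0∞ :=
  ⨅ (φ : MultAlg H₁ ≃ₐ[ℂ] MultAlg H₂) (_ : IsMultIso φ), cbDistortion φ

variable (H₁ H₂) in
/-- The multiplier Banach-Mazur distance between the multiplier algebras of `H₁` and `H₂`. -/
def rhoM : EReal := ENNReal.log (deltaM H₁ H₂)

variable (H₁ H₂) in
/-- The infimum of `‖φ‖_cb ‖φ⁻¹‖_cb` over all algebra isomorphisms between the multiplier
algebras of `H₁` and `H₂`. -/
def deltaAlg : ℝ≥0∞ := ⨅ φ : MultAlg H₁ ≃ₐ[ℂ] MultAlg H₂, cbDistortion φ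

end RKHSNotions

/-! ### The Drury-Arveson space -/

/-- The Drury-Arveson kernel `k(z, w) = 1 / (1 - ⟨z, w⟩)` on the ball, with complex numbers viewed
as operators on `ℂ`. -/
def daKernel (ι : Type*) : Matrix (UnitBall ι) (UnitBall ι) (ℂ →L[ℂ] ℂ) :=
  Matrix.of fun z w =>
    (1 / (1 - inner ℂ (w : HilbertCd ι) (z : HilbertCd ι))) • ContinuousLinearMap.id ℂ ℂ

open scoped ComplexOrder in
theorem posSemidef_inner_pow (ι : Type*) (k : ℕ) :
    (Matrix.of fun z w : UnitBall ι =>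
      (inner ℂ (w : HilbertCd ι) (z : HilbertCd ι)) ^ k).PosSemidef := by
  induction k with
  | zero =>
    refine ⟨by ext; simp, fun x => ?_⟩
    have : (x.sum fun i xi => x.sum fun j xj => star xi *
        (Matrix.of fun z w : UnitBall ι =>
          (inner ℂ (w : HilbertCd ι) (z : HilbertCd ι)) ^ 0) i j * xj)
        = star (x.sum fun _ xi => xi) * (x.sum fun _ xi => xi) := by
      simp [Finsupp.sum, Finset.sum_mul_sum]
    rw [this]
    exact star_mul_self_nonneg _
  | succ k ih =>
    have h1 : (Matrix.of fun z w : UnitBall ι =>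
        inner ℂ (w : HilbertCd ι) (z : HilbertCd ι)).PosSemidef := by
      refine ⟨by ext; simp, fun x => ?_⟩
      have : (x.sum fun i xi => x.sum fun j xj => star xi *
          (Matrix.of fun z w : UnitBall ι =>
            inner ℂ (w : HilbertCd ι) (z : HilbertCd ι)) i j * xj)
          = inner ℂ (∑ i ∈ x.support, star (x i) • (i : HilbertCd ι))
              (∑ i ∈ x.support, star (x i) • (i : HilbertCd ι)) := by
        simp only [Finsupp.sum, sum_inner, inner_sum, inner_smul_left, inner_smul_right,
          Matrix.of_apply]
        refine Finset.sum_congr rfl fun i _ => ?_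
        rw [Finset.mul_sum]
        refine Finset.sum_congr rfl fun j _ => ?_
        simp
        ring
      rw [this, inner_self_eq_norm_sq_to_K]
      simp
    have h2 : (Matrix.of fun z w : UnitBall ι =>
        (inner ℂ (w : HilbertCd ι) (z : HilbertCd ι)) ^ (k + 1))
        = Matrix.hadamard
          (Matrix.of fun z w : UnitBall ι => (inner ℂ (w : HilbertCd ι) (z : HilbertCd ι)) ^ k)
          (Matrix.of fun z w : UnitBall ι => inner ℂ (w : HilbertCd ι) (z : HilbertCd ι)) := by
      ext z w
      simp [pow_succ]
    rw [h2]
    exact ih.hadamard h1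

theorem norm_inner_lt_one {ι : Type*} (z w : UnitBall ι) :
    ‖(inner ℂ (w : HilbertCd ι) (z : HilbertCd ι) : ℂ)‖ < 1 := by
  have hz : ‖(z : HilbertCd ι)‖ < 1 := mem_ball_zero_iff.mp z.2
  have hw : ‖(w : HilbertCd ι)‖ < 1 := mem_ball_zero_iff.mp w.2
  calc _ ≤ ‖(w : HilbertCd ι)‖ * ‖(z : HilbertCd ι)‖ := norm_inner_le_norm _ _
    _ < 1 := by nlinarith [norm_nonneg (z : HilbertCd ι), norm_nonneg (w : HilbertCd ι)]

open scoped ComplexOrder in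
theorem posSemidef_daKernel (ι : Type*) : (daKernel ι).PosSemidef := by
  have hH : (daKernel ι).IsHermitian := by
    ext z w
    refine ext_inner_right ℂ fun v => ?_
    simp [daKernel, Matrix.conjTranspose_apply, ContinuousLinearMap.star_eq_adjoint,
      ContinuousLinearMap.adjoint_id]
  have tfae := (RKHS.posSemidef_tfae (K := daKernel ι)).out 0 2
  refine tfae.mpr ⟨hH, fun vv => ?_⟩
  have key : HasSum (fun k : ℕ => vv.sum fun x w => vv.sum fun x' w' =>
      w' * star w * (inner ℂ (x' : HilbertCd ι) (x : HilbertCd ι)) ^ k)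
      (vv.sum fun x w => vv.sum fun x' w' => inner ℂ (daKernel ι x' x w) w') := by
    refine hasSum_sum fun x _ => hasSum_sum fun x' _ => ?_
    have h := (hasSum_geometric_of_norm_lt_one (norm_inner_lt_one x x')).mul_left
      (vv x' * star (vv x))
    have e : inner ℂ (daKernel ι x' x (vv x)) (vv x')
        = vv x' * star (vv x) * (1 - inner ℂ (x' : HilbertCd ι) (x : HilbertCd ι))⁻¹ := by
      simp [daKernel]
      ring
    rw [← e] at h
    exact h
  have h3 := Complex.hasSum_re key
  refine h3.nonneg fun k => ?_
  have hk := (posSemidef_inner_pow ι k).2 vv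
  have hk' := (Complex.le_def.mp hk).1
  refine hk'.trans_eq (congrArg Complex.re ?_)
  refine Finset.sum_congr rfl fun i _ => Finset.sum_congr rfl fun j _ => ?_
  simp
  ring

instance instFactDaKernel (ι : Type*) : Fact (daKernel ι).PosSemidef :=
  ⟨posSemidef_daKernel ι⟩

/-- The Drury-Arveson space `H²_d`: the RKHS on the ball with kernel `1 / (1 - ⟨z, w⟩)`. -/
def DruryArveson (ι : Type*) : Type _ := RKHS.OfKernel (daKernel ι)

instance instNormedAddCommGroupDruryArveson (ι : Type*) : NormedAddCommGroup (DruryArveson ι) :=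
  inferInstanceAs (NormedAddCommGroup (RKHS.OfKernel (daKernel ι)))

instance instInnerProductSpaceDruryArveson (ι : Type*) : InnerProductSpace ℂ (DruryArveson ι) :=
  inferInstanceAs (InnerProductSpace ℂ (RKHS.OfKernel (daKernel ι)))

instance instCompleteSpaceDruryArveson (ι : Type*) : CompleteSpace (DruryArveson ι) :=
  inferInstanceAs (CompleteSpace (RKHS.OfKernel (daKernel ι)))

instance instRKHSDruryArveson (ι : Type*) : RKHS ℂ (DruryArveson ι) (UnitBall ι) ℂ :=
  inferInstanceAs (RKHS ℂ (RKHS.OfKernel (daKernel ι)) (UnitBall ι) ℂ)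

theorem kernel_druryArveson (ι : Type*) : RKHS.kernel (DruryArveson ι) = daKernel ι :=
  RKHS.OfKernel.kernel_ofKernel

/-- The quotient `H_X`, the closed linear span in `H²_d` of the kernel functions at the points
of `X`. -/
abbrev daQuotient {ι : Type*} (X : Set (UnitBall ι)) : Submodule ℂ (DruryArveson ι) :=
  (Submodule.span ℂ ((fun x => kerAt (DruryArveson ι) x) '' X)).topologicalClosure

/-- `H_X` is a space of functions on `X`, by restriction. -/
instance instRKHSDaQuotient {ι : Type*} (X : Set (UnitBall ι)) :
    RKHS ℂ (daQuotient X) X ℂ where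
  coeCLM := ContinuousLinearMap.pi fun x : X =>
    ContinuousLinearMap.proj (x : UnitBall ι) ∘L RKHS.coeCLM ℂ ∘L (daQuotient X).subtypeL
  coeCLM_injective := by
    refine (injective_iff_map_eq_zero _).mpr fun f hf => ?_
    have h0 : ∀ x ∈ X, (f : DruryArveson ι) x = 0 := fun x hx => congrFun hf ⟨x, hx⟩
    have h1 : (f : DruryArveson ι) ∈ (daQuotient X)ᗮ := by
      rw [Submodule.orthogonal_closure, Submodule.mem_orthogonal]
      intro u hu
      induction hu using Submodule.span_induction with
      | mem u hu =>
        obtain ⟨x, hx, rfl⟩ := hu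
        simp [kerAt, h0 x hx]
      | zero => simp
      | add u v _ _ hu hv => simp [inner_add_left, hu, hv]
      | smul c u _ hu => simp [inner_smul_left, hu]
    have h2 : inner ℂ (f : DruryArveson ι) (f : DruryArveson ι) = (0 : ℂ) :=
      Submodule.inner_right_of_mem_orthogonal f.2 h1
    exact Subtype.ext (inner_self_eq_zero.mp h2)

/-! ### The multiplier discrepancy -/

/-- `M` is the row multiplication operator `(h_i)_i ↦ ∑_i F_i h_i` of the vector valued function
`F = (F_i)_i` on the ball, from the direct sum of `d` copies of `H²_d` to `H²_d`. -/
def IsRowMultOp {ι : Type*} (F : UnitBall ι → HilbertCd ι)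
    (M : lp (fun _ : ι => DruryArveson ι) 2 →L[ℂ] DruryArveson ι) : Prop :=
  ∀ (h : lp (fun _ : ι => DruryArveson ι) 2) (z : UnitBall ι),
    HasSum (fun i : ι => F z i * (h i : DruryArveson ι) z) (M h z)

/-- The multiplier norm `‖M_F‖` of a vector valued function on the ball (`∞` if it is not a
multiplier). -/
def rowMultNorm {ι : Type*} (F : UnitBall ι → HilbertCd ι) : ℝ≥0∞ :=
  ⨅ (M : lp (fun _ : ι => DruryArveson ι) 2 →L[ℂ] DruryArveson ι) (_ : IsRowMultOp F M), ‖M‖ₑ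

/-- The multiplier discrepancy: the infimum of `max {‖F‖, ‖G‖}` over all vector valued multipliers
`F`, `G` such that `F` restricts to a bijection of `X` onto `Y` and `G` restricts to its
inverse. -/
def deltaMult {ι : Type*} (X Y : Set (UnitBall ι)) : ℝ≥0∞ :=
  ⨅ (F : UnitBall ι → HilbertCd ι) (G : UnitBall ι → HilbertCd ι)
    (_ : ∃ σ : X ≃ Y, (∀ x : X, F x = (σ x : UnitBall ι)) ∧
      ∀ y : Y, G y = (σ.symm y : UnitBall ι)),
    max (rowMultNorm F) (rowMultNorm G)

end

/-! Every automorphism of the ball rescales the kernel: `1 - ⟨Φ z, Φ w⟩ = g(z) conj(g w) (1 - ⟨z,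
w⟩)` (`IsBiholomorphic.preservesKernel`). Hence a point set may be moved by automorphisms at the
price of rescaling its kernel functions, and the rest is a comparison of Gram matrices.

(1) ⇒ (2): after an automorphism the points of `Y k` lie close to those of `X`, so the kernel
functions are close too. Sending `k_x` to a suitable multiple of `k_{τ x}` is then almost isometric,
because the coefficients of a vector of `H_X` are controlled by its norm (`deltaRK_le`). (2) ⇒ (3):
conjugating multiplication operators by the adjoint of an RKHS isomorphism gives a multiplier
isomorphism with at most the squared distortion (`deltaM_le_deltaRK_sq`). (3) ⇒ (4) compares infima.

(4) ⇒ (1) is the main step. On finite sets every algebra isomorphism is composition with a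
bijection. The coordinate functions of the ball form a row contraction, so complete boundedness by
`c` in both directions makes two kernels `(c² - ⟨·,·⟩) / (1 - ⟨·,·⟩)` positive. With matching base
points moved to the origin, positivity on three points bounds the difference of the Gram matrices of
the two point sets by a quantity that depends only on `X` and `c` and vanishes as `c → 1`
(`gram_estimate_of_algEquiv`). Convergence of Gram matrices yields unitaries that align the points
(`exists_unitary_tendsto_of_gram`).

For the discrepancy, automorphisms are row contractions; finitely many values are corrected by
interpolating multipliers of bounded norm (`exists_isRowMultOp_perturbation`). The lower bound `1`
holds because row multipliers of norm less than one strictly shrink the pseudohyperbolic metric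
(`IsRowMultOp.rhoPh_lt`). -/

noncomputable section

open scoped ComplexConjugate

/-! ### Automorphisms of the ball and the pseudohyperbolic metric. -/

section MoebiusMaps

variable {ι : Type*}

theorem exists_smul_add_orthogonal (a z : HilbertCd ι) :
    ∃ (t : ℂ) (v : HilbertCd ι), inner ℂ a v = 0 ∧ z = t • a + v := by
  -- For `a = 0` the quotient is `0 / 0 = 0`, so the same witness serves.
  refine ⟨inner ℂ a z / inner ℂ a a, z - (inner ℂ a z / inner ℂ a a) • a, ?_, by abel⟩
  rw [inner_sub_right, inner_smul_right]
  rcases eq_or_ne a 0 with rfl | ha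
  · simp
  · rw [div_mul_cancel₀ _ (inner_self_ne_zero.mpr ha), sub_self]

theorem elemAut_smul_add {a v : HilbertCd ι} (t : ℂ) (hv : inner ℂ a v = 0) :
    elemAut a (t • a + v) = (1 - t * (‖a‖ : ℂ) ^ 2)⁻¹ •
      ((1 - t) • a - (Real.sqrt (1 - ‖a‖ ^ 2) : ℂ) • v) := by
  have hp : (Submodule.span ℂ {a}).starProjection (t • a + v) = t • a := by
    rw [map_add, (Submodule.starProjection_apply_eq_zero_iff _).mpr
      (Submodule.mem_orthogonal_singleton_iff_inner_right.mpr hv), add_zero,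
      Submodule.starProjection_eq_self_iff.mpr
        (Submodule.smul_mem _ _ (Submodule.mem_span_singleton_self a))]
  rw [elemAut, hp, inner_add_right, inner_smul_right, hv, inner_self_eq_norm_sq_to_K]
  simp only [add_zero, Complex.coe_algebraMap, add_sub_cancel_left]
  congr 2
  rw [sub_smul, one_smul]

theorem one_sub_inner_ne_zero {a z : HilbertCd ι} (ha : ‖a‖ < 1) (hz : ‖z‖ < 1) :
    (1 - inner ℂ a z : ℂ) ≠ 0 := by
  intro h
  have h1 : (inner ℂ a z : ℂ) = 1 := (sub_eq_zero.mp h).symm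
  have h2 := norm_inner_le_norm (𝕜 := ℂ) a z
  rw [h1, norm_one] at h2
  nlinarith [norm_nonneg a, norm_nonneg z]

theorem sqrt_one_sub_sq (a : HilbertCd ι) (ha : ‖a‖ < 1) :
    (Real.sqrt (1 - ‖a‖ ^ 2) : ℂ) ^ 2 = 1 - (‖a‖ : ℂ) ^ 2 := by
  rw [← Complex.ofReal_pow, Real.sq_sqrt (by nlinarith [norm_nonneg a])]
  push_cast
  ring

theorem sqrt_one_sub_ne_zero (a : HilbertCd ι) (ha : ‖a‖ < 1) :
    (Real.sqrt (1 - ‖a‖ ^ 2) : ℂ) ≠ 0 := by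
  have : 0 < 1 - ‖a‖ ^ 2 := by nlinarith [norm_nonneg a]
  exact_mod_cast (Real.sqrt_pos.mpr this).ne'

/-- In coordinates `z = t a + v`, `w = u a + y` with `v, y ⟂ a` this is a rational identity modulo
`s² = 1 - ‖a‖²`. Self-mapping of the ball, the formula for `rhoPh` and the rescaling of the kernel
all come from it. -/
theorem one_sub_inner_elemAut {a z w : HilbertCd ι} (ha : ‖a‖ < 1) (hz : ‖z‖ < 1)
    (hw : ‖w‖ < 1) :
    (1 - inner ℂ (elemAut a w) (elemAut a z) : ℂ) =
      (Real.sqrt (1 - ‖a‖ ^ 2) / (1 - inner ℂ a z)) *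
        conj (Real.sqrt (1 - ‖a‖ ^ 2) / (1 - inner ℂ a w) : ℂ) * (1 - inner ℂ w z) := by
  have hz0 := one_sub_inner_ne_zero ha hz
  have hw0 := one_sub_inner_ne_zero ha hw
  have hs := sqrt_one_sub_sq a ha
  obtain ⟨t, v, hv, rfl⟩ := exists_smul_add_orthogonal a z
  obtain ⟨u, y, hy, rfl⟩ := exists_smul_add_orthogonal a w
  rw [elemAut_smul_add _ hv, elemAut_smul_add _ hy]
  have hy' : inner ℂ y a = 0 := inner_eq_zero_symm.mp hy
  simp only [inner_add_right, inner_smul_right, hv, hy, inner_self_eq_norm_sq_to_K,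
    Complex.coe_algebraMap, add_zero] at hz0 hw0 ⊢
  simp only [inner_add_left, inner_sub_left, inner_sub_right, inner_smul_left,
    inner_smul_right, hv, hy', inner_self_eq_norm_sq_to_K, map_div₀, map_sub, map_mul, map_one,
    map_pow, map_inv₀, Complex.conj_ofReal, Complex.coe_algebraMap]
  have hw1 : (1 - conj u * (‖a‖ : ℂ) ^ 2 : ℂ) ≠ 0 := by
    have := (map_ne_zero (starRingEnd ℂ)).mpr hw0
    simpa using this
  generalize (Real.sqrt (1 - ‖a‖ ^ 2) : ℂ) = s at *
  generalize inner ℂ y v = q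
  generalize (‖a‖ : ℂ) = r at *
  generalize conj u = u' at *
  have hw2 : 1 - r ^ 2 * u' ≠ 0 := by rwa [mul_comm]
  field_simp
  linear_combination (-(1 : ℂ) + r ^ 2 * t * u') * hs

theorem elemAut_zero (a : HilbertCd ι) : elemAut a 0 = a := by
  simp [elemAut]

theorem elemAut_self (a : HilbertCd ι) : elemAut a a = 0 := by
  have := elemAut_smul_add (a := a) (v := 0) 1 (by simp)
  simpa using this

theorem norm_elemAut_lt_one {a z : HilbertCd ι} (ha : ‖a‖ < 1) (hz : ‖z‖ < 1) :
    ‖elemAut a z‖ < 1 := by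
  have h := one_sub_inner_elemAut ha hz hz
  rw [inner_self_eq_norm_sq_to_K, inner_self_eq_norm_sq_to_K, Complex.mul_conj,
    Complex.normSq_eq_norm_sq] at h
  simp only [Complex.coe_algebraMap] at h
  have h' : 1 - ‖elemAut a z‖ ^ 2 =
      ‖(Real.sqrt (1 - ‖a‖ ^ 2) / (1 - inner ℂ a z) : ℂ)‖ ^ 2 * (1 - ‖z‖ ^ 2) := by
    exact_mod_cast h
  have h1 : 0 < ‖(Real.sqrt (1 - ‖a‖ ^ 2) / (1 - inner ℂ a z) : ℂ)‖ :=
    norm_pos_iff.mpr (div_ne_zero (sqrt_one_sub_ne_zero a ha) (one_sub_inner_ne_zero ha hz))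
  have h2 : 0 < 1 - ‖z‖ ^ 2 := by nlinarith [norm_nonneg z]
  have h3 : 0 < 1 - ‖elemAut a z‖ ^ 2 := h' ▸ by positivity
  nlinarith [norm_nonneg (elemAut a z)]

theorem elemAut_elemAut {a z : HilbertCd ι} (ha : ‖a‖ < 1) (hz : ‖z‖ < 1) :
    elemAut a (elemAut a z) = z := by
  have hz0 := one_sub_inner_ne_zero ha hz
  have hs := sqrt_one_sub_sq a ha
  have hs0 := sqrt_one_sub_ne_zero a ha
  obtain ⟨t, v, hv, rfl⟩ := exists_smul_add_orthogonal a z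
  simp only [inner_add_right, inner_smul_right, hv, inner_self_eq_norm_sq_to_K,
    Complex.coe_algebraMap, add_zero] at hz0
  rw [elemAut_smul_add _ hv, smul_sub, smul_smul, smul_smul, sub_eq_add_neg, ← neg_smul,
    elemAut_smul_add _ (by rw [inner_smul_right, hv, mul_zero]), smul_sub, smul_smul, smul_smul,
    smul_smul, sub_eq_add_neg, ← neg_smul]
  have hD : 1 - (1 - t * (‖a‖ : ℂ) ^ 2)⁻¹ * (1 - t) * (‖a‖ : ℂ) ^ 2 =
      (1 - t * (‖a‖ : ℂ) ^ 2)⁻¹ * (Real.sqrt (1 - ‖a‖ ^ 2) : ℂ) ^ 2 := by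
    rw [hs]
    field_simp
    ring
  rw [hD]
  generalize (Real.sqrt (1 - ‖a‖ ^ 2) : ℂ) = s at *
  generalize (‖a‖ : ℂ) = r at *
  congr 1
  · congr 1
    field_simp
    linear_combination (-t) * hs
  · convert one_smul ℂ v using 2
    field_simp

theorem differentiableOn_elemAut {a : HilbertCd ι} (ha : ‖a‖ < 1) :
    DifferentiableOn ℂ (elemAut a) (Metric.ball 0 1) := by
  intro z hz
  have h0 := one_sub_inner_ne_zero ha (mem_ball_zero_iff.mp hz)
  have h1 : DifferentiableAt ℂ (fun z : HilbertCd ι => (1 - inner ℂ a z : ℂ)) z :=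
    (differentiableAt_const _).sub (innerSL ℂ a).differentiableAt
  have h2 : DifferentiableAt ℂ (fun z : HilbertCd ι =>
      (Submodule.span ℂ {a}).starProjection z) z :=
    ContinuousLinearMap.differentiableAt _
  have h3 : DifferentiableAt ℂ (fun z : HilbertCd ι =>
      a - (Submodule.span ℂ {a}).starProjection z) z := h2.const_sub a
  have h4 : DifferentiableAt ℂ (fun z : HilbertCd ι =>
      z - (Submodule.span ℂ {a}).starProjection z) z := differentiableAt_fun_id.fun_sub h2
  have h5 := h3.fun_sub (h4.fun_const_smul (Real.sqrt (1 - ‖a‖ ^ 2) : ℂ))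
  exact ((h1.fun_inv h0).fun_smul h5).differentiableWithinAt

/-- The elementary automorphism `Ψ_a` as a bijection of the ball. -/
def moebius (a : UnitBall ι) : UnitBall ι ≃ UnitBall ι :=
  Function.Involutive.toPerm
    (fun z => ⟨elemAut a z, mem_ball_zero_iff.mpr
      (norm_elemAut_lt_one (mem_ball_zero_iff.mp a.2) (mem_ball_zero_iff.mp z.2))⟩)
    (fun z => Subtype.ext
      (elemAut_elemAut (mem_ball_zero_iff.mp a.2) (mem_ball_zero_iff.mp z.2)))

theorem moebius_moebius (a z : UnitBall ι) : moebius a (moebius a z) = z :=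
  (moebius a).symm_apply_apply z

theorem moebius_self (a : UnitBall ι) : (moebius a a : HilbertCd ι) = 0 := elemAut_self _

/-- A self-map of the ball which rescales the Drury-Arveson kernel. -/
def PreservesKernel (Φ : UnitBall ι → UnitBall ι) : Prop :=
  ∃ g : UnitBall ι → ℂ, ∀ z w : UnitBall ι,
    (1 - inner ℂ (Φ w : HilbertCd ι) (Φ z : HilbertCd ι) : ℂ) =
      g z * conj (g w) * (1 - inner ℂ (w : HilbertCd ι) (z : HilbertCd ι))

theorem preservesKernel_moebius (a : UnitBall ι) : PreservesKernel (moebius a) :=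
  ⟨_, fun z w => one_sub_inner_elemAut (mem_ball_zero_iff.mp a.2) (mem_ball_zero_iff.mp z.2)
    (mem_ball_zero_iff.mp w.2)⟩

theorem UnitBall.one_sub_inner_ne_zero (z w : UnitBall ι) :
    (1 - inner ℂ (z : HilbertCd ι) (w : HilbertCd ι) : ℂ) ≠ 0 :=
  _root_.one_sub_inner_ne_zero (mem_ball_zero_iff.mp z.2) (mem_ball_zero_iff.mp w.2)

theorem PreservesKernel.comp {Φ Ψ : UnitBall ι → UnitBall ι} (hΦ : PreservesKernel Φ)
    (hΨ : PreservesKernel Ψ) : PreservesKernel (Φ ∘ Ψ) := by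
  obtain ⟨g, hg⟩ := hΦ
  obtain ⟨h, hh⟩ := hΨ
  refine ⟨fun z => g (Ψ z) * h z, fun z w => ?_⟩
  rw [Function.comp_apply, Function.comp_apply, hg, hh, map_mul]
  ring

theorem PreservesKernel.exists_ne_zero {Φ : UnitBall ι → UnitBall ι} (hΦ : PreservesKernel Φ) :
    ∃ g : UnitBall ι → ℂ, (∀ z, g z ≠ 0) ∧ ∀ z w : UnitBall ι,
      (1 - inner ℂ (Φ w : HilbertCd ι) (Φ z : HilbertCd ι) : ℂ) =
        g z * conj (g w) * (1 - inner ℂ (w : HilbertCd ι) (z : HilbertCd ι)) := by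
  obtain ⟨g, hg⟩ := hΦ
  refine ⟨g, fun z hz => UnitBall.one_sub_inner_ne_zero (Φ z) (Φ z) ?_, hg⟩
  rw [hg, hz, zero_mul, zero_mul]

theorem PreservesKernel.symm {Φ : UnitBall ι ≃ UnitBall ι} (hΦ : PreservesKernel Φ) :
    PreservesKernel Φ.symm := by
  obtain ⟨g, hg0, hg⟩ := hΦ.exists_ne_zero
  refine ⟨fun z => (g (Φ.symm z))⁻¹, fun z w => ?_⟩
  have := hg (Φ.symm z) (Φ.symm w)
  rw [Φ.apply_symm_apply, Φ.apply_symm_apply] at this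
  have h1 := hg0 (Φ.symm z)
  have h2 := (map_ne_zero (starRingEnd ℂ)).mpr (hg0 (Φ.symm w))
  rw [this, map_inv₀]
  field_simp

/-- Diagonal case of the kernel identity. It expresses `rhoPh` through the kernel alone, which makes
symmetry visible, as well as invariance under kernel-rescaling maps: the scaling factors cancel. -/
theorem one_sub_rhoPh_sq (z w : UnitBall ι) :
    1 - rhoPh z w ^ 2 = (1 - ‖(z : HilbertCd ι)‖ ^ 2) * (1 - ‖(w : HilbertCd ι)‖ ^ 2) /
      ‖(1 - inner ℂ (w : HilbertCd ι) (z : HilbertCd ι) : ℂ)‖ ^ 2 := by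
  have hw := mem_ball_zero_iff.mp w.2
  have hz := mem_ball_zero_iff.mp z.2
  have h := one_sub_inner_elemAut hw hz hz
  rw [inner_self_eq_norm_sq_to_K, inner_self_eq_norm_sq_to_K, Complex.mul_conj,
    Complex.normSq_eq_norm_sq] at h
  simp only [Complex.coe_algebraMap] at h
  have h' : 1 - ‖elemAut (w : HilbertCd ι) z‖ ^ 2 =
      ‖(Real.sqrt (1 - ‖(w : HilbertCd ι)‖ ^ 2) / (1 - inner ℂ (w : HilbertCd ι) z) : ℂ)‖ ^ 2 *
        (1 - ‖(z : HilbertCd ι)‖ ^ 2) := by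
    exact_mod_cast h
  rw [rhoPh, h', norm_div, div_pow, Complex.norm_real, Real.norm_eq_abs, sq_abs,
    Real.sq_sqrt (by nlinarith [norm_nonneg (w : HilbertCd ι)])]
  ring

theorem rhoPh_nonneg (z w : UnitBall ι) : 0 ≤ rhoPh z w := norm_nonneg _

theorem rhoPh_lt_one (z w : UnitBall ι) : rhoPh z w < 1 :=
  norm_elemAut_lt_one (mem_ball_zero_iff.mp w.2) (mem_ball_zero_iff.mp z.2)

theorem rhoPh_comm (z w : UnitBall ι) : rhoPh z w = rhoPh w z := by
  refine (sq_eq_sq₀ (rhoPh_nonneg _ _) (rhoPh_nonneg _ _)).mp ?_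
  have h1 := one_sub_rhoPh_sq z w
  have h2 := one_sub_rhoPh_sq w z
  have h3 : ‖(1 - inner ℂ (w : HilbertCd ι) (z : HilbertCd ι) : ℂ)‖ =
      ‖(1 - inner ℂ (z : HilbertCd ι) (w : HilbertCd ι) : ℂ)‖ := by
    rw [← Complex.norm_conj, map_sub, map_one, inner_conj_symm]
  rw [h3] at h1
  rw [mul_comm] at h2
  linarith

theorem PreservesKernel.rhoPh_eq {Φ : UnitBall ι → UnitBall ι} (hΦ : PreservesKernel Φ)
    (z w : UnitBall ι) : rhoPh (Φ z) (Φ w) = rhoPh z w := by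
  obtain ⟨g, hg0, hg⟩ := hΦ.exists_ne_zero
  have hd : ∀ x : UnitBall ι, 1 - ‖(Φ x : HilbertCd ι)‖ ^ 2 =
      ‖g x‖ ^ 2 * (1 - ‖(x : HilbertCd ι)‖ ^ 2) := fun x => by
    have h := hg x x
    rw [inner_self_eq_norm_sq_to_K, inner_self_eq_norm_sq_to_K, Complex.mul_conj,
      Complex.normSq_eq_norm_sq] at h
    simp only [Complex.coe_algebraMap] at h
    exact_mod_cast h
  refine (sq_eq_sq₀ (rhoPh_nonneg _ _) (rhoPh_nonneg _ _)).mp ?_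
  have h1 := one_sub_rhoPh_sq (Φ z) (Φ w)
  have h2 := one_sub_rhoPh_sq z w
  rw [hd, hd, hg, norm_mul, norm_mul, Complex.norm_conj] at h1
  have e1 := norm_pos_iff.mpr (hg0 z)
  have e2 := norm_pos_iff.mpr (hg0 w)
  have e3 := norm_pos_iff.mpr (UnitBall.one_sub_inner_ne_zero w z)
  have : 1 - rhoPh (Φ z) (Φ w) ^ 2 = 1 - rhoPh z w ^ 2 := by
    rw [h1, h2]
    field_simp
  linarith

/-- With `u = Ψ_w(z)` one has `z = Ψ_w(u)`, and `z - w` is a vector of norm at most `‖u‖` divided by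
`1 - ⟨u, w⟩`. The bound does not involve `w`, so it stays usable for points that approach the
sphere. -/
theorem norm_sub_le_rhoPh (z w : UnitBall ι) :
    ‖(z : HilbertCd ι) - w‖ ≤ rhoPh z w / (1 - rhoPh z w) := by
  have hw := mem_ball_zero_iff.mp w.2
  have hz := mem_ball_zero_iff.mp z.2
  have hρ := rhoPh_lt_one z w
  have hu := elemAut_elemAut hw hz
  have hs1 := sqrt_one_sub_sq _ hw
  rw [rhoPh] at *
  generalize (w : HilbertCd ι) = a at *
  generalize (z : HilbertCd ι) = z at *
  generalize elemAut a z = u at *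
  subst hu
  have hu0 := one_sub_inner_ne_zero hw hρ
  have hin : 1 - ‖u‖ ≤ ‖(1 - inner ℂ a u : ℂ)‖ := by
    have h1 := norm_sub_norm_le (1 : ℂ) (inner ℂ a u)
    have h2 := norm_inner_le_norm (𝕜 := ℂ) a u
    rw [norm_one] at h1
    nlinarith [norm_nonneg u]
  obtain ⟨t, v, hv, rfl⟩ := exists_smul_add_orthogonal a u
  have hD : (inner ℂ a (t • a + v) : ℂ) = t * (‖a‖ : ℂ) ^ 2 := by
    rw [inner_add_right, inner_smul_right, hv, inner_self_eq_norm_sq_to_K]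
    simp
  rw [elemAut_smul_add _ hv]
  rw [hD] at hin hu0
  have key : (1 - t * (‖a‖ : ℂ) ^ 2)⁻¹ •
      ((1 - t) • a - (Real.sqrt (1 - ‖a‖ ^ 2) : ℂ) • v) - a =
      (1 - t * (‖a‖ : ℂ) ^ 2)⁻¹ • (-((Real.sqrt (1 - ‖a‖ ^ 2) : ℂ) •
        ((Real.sqrt (1 - ‖a‖ ^ 2) : ℂ) • (t • a) + v))) := by
    rw [smul_add, smul_smul, ← pow_two, hs1]
    match_scalars <;> field_simp
    ring
  have hs0 := Real.sqrt_nonneg (1 - ‖a‖ ^ 2)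
  have hsle : Real.sqrt (1 - ‖a‖ ^ 2) ≤ 1 := Real.sqrt_le_one.mpr (by nlinarith [norm_nonneg a])
  have horth : ‖(Real.sqrt (1 - ‖a‖ ^ 2) : ℂ) • (t • a) + v‖ ≤ ‖t • a + v‖ := by
    have p1 := norm_add_sq_eq_norm_sq_add_norm_sq_of_inner_eq_zero (𝕜 := ℂ) (t • a) v
      (by rw [inner_smul_left, hv, mul_zero])
    have p2 := norm_add_sq_eq_norm_sq_add_norm_sq_of_inner_eq_zero (𝕜 := ℂ)
      ((Real.sqrt (1 - ‖a‖ ^ 2) : ℂ) • (t • a)) v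
      (by rw [inner_smul_left, inner_smul_left, hv, mul_zero, mul_zero])
    have p3 : ‖(Real.sqrt (1 - ‖a‖ ^ 2) : ℂ) • (t • a)‖ ≤ ‖t • a‖ := by
      rw [norm_smul, Complex.norm_real, Real.norm_of_nonneg hs0]
      exact mul_le_of_le_one_left (norm_nonneg _) hsle
    refine le_of_sq_le_sq ?_ (norm_nonneg _)
    nlinarith [norm_nonneg ((Real.sqrt (1 - ‖a‖ ^ 2) : ℂ) • (t • a)), norm_nonneg (t • a)]
  rw [key, norm_smul, norm_neg, norm_smul, norm_inv, Complex.norm_real,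
    Real.norm_of_nonneg hs0, inv_mul_eq_div]
  refine div_le_div₀ (norm_nonneg _) ?_ (by linarith) hin
  nlinarith [norm_nonneg ((Real.sqrt (1 - ‖a‖ ^ 2) : ℂ) • (t • a) + v)]

theorem tendsto_rhoPh_zero {α : Type*} {l : Filter α} (x : UnitBall ι) {f : α → UnitBall ι}
    (hf : Tendsto (fun k => (f k : HilbertCd ι)) l (𝓝 x)) :
    Tendsto (fun k => rhoPh x (f k)) l (𝓝 0) := by
  have hx : 0 < 1 - ‖(x : HilbertCd ι)‖ ^ 2 := by
    nlinarith [norm_nonneg (x : HilbertCd ι), mem_ball_zero_iff.mp x.2]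
  have h1 : Tendsto (fun k => rhoPh x (f k) ^ 2) l (𝓝 0) := by
    have e : ∀ k, rhoPh x (f k) ^ 2 = 1 - (1 - ‖(x : HilbertCd ι)‖ ^ 2) *
        (1 - ‖(f k : HilbertCd ι)‖ ^ 2) /
        ‖(1 - inner ℂ (f k : HilbertCd ι) (x : HilbertCd ι) : ℂ)‖ ^ 2 := fun k => by
      rw [← one_sub_rhoPh_sq]; ring
    simp_rw [e]
    have e0 : (0 : ℝ) = 1 - (1 - ‖(x : HilbertCd ι)‖ ^ 2) *
        (1 - ‖(x : HilbertCd ι)‖ ^ 2) /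
        ‖(1 - inner ℂ (x : HilbertCd ι) (x : HilbertCd ι) : ℂ)‖ ^ 2 := by
      rw [← one_sub_rhoPh_sq, rhoPh, elemAut_self, norm_zero]; ring
    rw [e0]
    refine tendsto_const_nhds.sub (Tendsto.div (tendsto_const_nhds.mul
      (tendsto_const_nhds.sub (hf.norm.pow 2)))
      ((tendsto_const_nhds.sub (hf.inner tendsto_const_nhds)).norm.pow 2) ?_)
    exact pow_ne_zero _ (norm_ne_zero_iff.mpr (UnitBall.one_sub_inner_ne_zero x x))
  have h2 := h1.sqrt
  simpa [Real.sqrt_sq (rhoPh_nonneg _ _)] using h2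

theorem IsBiholomorphic.trans {Φ Ψ : UnitBall ι ≃ UnitBall ι} (hΦ : IsBiholomorphic Φ)
    (hΨ : IsBiholomorphic Ψ) : IsBiholomorphic (Φ.trans Ψ) := by
  obtain ⟨⟨f, hf, hf'⟩, g, hg, hg'⟩ := hΦ
  obtain ⟨⟨p, hp, hp'⟩, q, hq, hq'⟩ := hΨ
  refine ⟨⟨p ∘ f, hp.comp hf fun z hz => ?_, fun z => ?_⟩,
    g ∘ q, hg.comp hq fun z hz => ?_, fun z => ?_⟩
  · rw [hf' ⟨z, hz⟩]; exact (Φ ⟨z, hz⟩).2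
  · simp [hf', hp']
  · rw [hq' ⟨z, hz⟩]; exact (Ψ.symm ⟨z, hz⟩).2
  · simp [hq', hg']

theorem IsBiholomorphic.symm {Φ : UnitBall ι ≃ UnitBall ι} (hΦ : IsBiholomorphic Φ) :
    IsBiholomorphic Φ.symm :=
  ⟨hΦ.2, hΦ.1⟩

theorem isBiholomorphic_moebius (a : UnitBall ι) : IsBiholomorphic (moebius a) :=
  ⟨⟨_, differentiableOn_elemAut (mem_ball_zero_iff.mp a.2), fun _ => rfl⟩,
    ⟨_, differentiableOn_elemAut (mem_ball_zero_iff.mp a.2), fun _ => rfl⟩⟩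

/-- The restriction of a unitary operator to the ball. -/
def unitaryBall (U : HilbertCd ι ≃ₗᵢ[ℂ] HilbertCd ι) : UnitBall ι ≃ UnitBall ι where
  toFun z := ⟨U z, by simpa [-Subtype.coe_prop] using mem_ball_zero_iff.mp z.2⟩
  invFun z := ⟨U.symm z, by simpa [-Subtype.coe_prop] using mem_ball_zero_iff.mp z.2⟩
  left_inv z := by simp
  right_inv z := by simp

theorem isBiholomorphic_unitaryBall (U : HilbertCd ι ≃ₗᵢ[ℂ] HilbertCd ι) :
    IsBiholomorphic (unitaryBall U) :=
  ⟨⟨U, U.toContinuousLinearEquiv.differentiable.differentiableOn, fun _ => rfl⟩,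
    ⟨U.symm, U.symm.toContinuousLinearEquiv.differentiable.differentiableOn, fun _ => rfl⟩⟩

/-- A holomorphic norm preserving self-map of the ball is the restriction of its derivative. -/
theorem eq_fderiv_of_norm_eq {E : Type*} [NormedAddCommGroup E] [InnerProductSpace ℂ E]
    {f : E → E} (hf : DifferentiableOn ℂ f (Metric.ball 0 1))
    (hn : ∀ z, ‖z‖ < 1 → ‖f z‖ = ‖z‖) {z : E} (hz : ‖z‖ < 1) : f z = fderiv ℂ f 0 z := by
  have h0 : f 0 = 0 := by simpa using hn 0 (by simp)
  rcases eq_or_ne z 0 with rfl | hz0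
  · simp [h0]
  have hzn : 0 < ‖z‖ := norm_pos_iff.mpr hz0
  let e : E := (‖z‖⁻¹ : ℂ) • z
  have he : ‖e‖ = 1 := by
    simp [e, norm_smul, hzn.ne']
  have hmem : ∀ t : ℂ, t ∈ Metric.ball (0 : ℂ) 1 → ‖t • e‖ < 1 := fun t ht => by
    rw [norm_smul, he, mul_one]
    exact mem_ball_zero_iff.mp ht
  have hφ : DifferentiableOn ℂ (fun t : ℂ => f (t • e)) (Metric.ball 0 1) :=
    hf.comp ((differentiable_id.smul_const e).differentiableOn)
      fun t ht => mem_ball_zero_iff.mpr (hmem t ht)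
  have hmaps : Set.MapsTo (fun t : ℂ => f (t • e)) (Metric.ball 0 1)
      (Metric.closedBall ((fun t : ℂ => f (t • e)) 0) 1) := fun t ht => by
    simp only [zero_smul, h0]
    rw [mem_closedBall_zero_iff, hn _ (hmem t ht)]
    exact (hmem t ht).le
  have hzmem : (‖z‖ : ℂ) ∈ Metric.ball (0 : ℂ) 1 := by simpa using hz
  have hzc : (‖z‖ : ℂ) ≠ 0 := by exact_mod_cast hzn.ne'
  have hze : (‖z‖ : ℂ) • e = z := by simp [e, smul_smul, hzc]
  have hds : dslope (fun t : ℂ => f (t • e)) 0 (‖z‖ : ℂ) = (‖z‖ : ℂ)⁻¹ • f z := by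
    rw [dslope_of_ne _ hzc, slope_def_module]
    simp [h0, hze]
  have : StrictConvexSpace ℝ E := by
    let := InnerProductSpace.rclikeToReal ℂ E
    infer_instance
  -- Equality holds in the Schwarz lemma on the disc through `z`; strict convexity then forces the
  -- slice `t ↦ f (t • e)` to be linear, and its slope is the derivative at `0`.
  have haff := Complex.affine_of_mapsTo_ball_of_norm_dslope_eq_div hφ hmaps hzmem
    (by rw [hds, norm_smul, hn z hz, norm_inv, Complex.norm_real, norm_norm]
        simp [hzn.ne'])
  rw [hds] at haff
  have hder : HasDerivAt (fun t : ℂ => f (t • e)) (fderiv ℂ f 0 e) 0 := by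
    have h1 : HasFDerivAt f (fderiv ℂ f 0) ((0 : ℂ) • e) := by
      rw [zero_smul]
      exact (hf.differentiableAt (Metric.ball_mem_nhds 0 one_pos)).hasFDerivAt
    have h2 : HasDerivAt (fun t : ℂ => t • e) e 0 := by
      simpa using (hasDerivAt_id (0 : ℂ)).smul_const e
    exact h1.comp_hasDerivAt _ h2
  have hder' : HasDerivAt (fun t : ℂ => f (t • e)) ((‖z‖ : ℂ)⁻¹ • f z) 0 := by
    have h2 : HasDerivAt (fun t : ℂ => t • ((‖z‖ : ℂ)⁻¹ • f z)) ((‖z‖ : ℂ)⁻¹ • f z) 0 := by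
      simpa using (hasDerivAt_id (0 : ℂ)).smul_const ((‖z‖ : ℂ)⁻¹ • f z)
    refine h2.congr_of_eventuallyEq ?_
    filter_upwards [Metric.ball_mem_nhds (0 : ℂ) one_pos] with t ht
    simpa [h0] using haff ht
  have := hder.unique hder'
  calc f z = (‖z‖ : ℂ) • ((‖z‖ : ℂ)⁻¹ • f z) := by rw [smul_smul, mul_inv_cancel₀ hzc, one_smul]
    _ = fderiv ℂ f 0 z := by rw [← this, ← map_smul, hze]

/-- The derivative at `0` preserves norms on the ball, hence everywhere by scaling, and a linear
isometry preserves inner products. -/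
theorem inner_eq_of_norm_eq {E : Type*} [NormedAddCommGroup E] [InnerProductSpace ℂ E]
    {f : E → E} (hf : DifferentiableOn ℂ f (Metric.ball 0 1))
    (hn : ∀ z, ‖z‖ < 1 → ‖f z‖ = ‖z‖) {z w : E} (hz : ‖z‖ < 1) (hw : ‖w‖ < 1) :
    (inner ℂ (f w) (f z) : ℂ) = inner ℂ w z := by
  have hL : ∀ z : E, ‖fderiv ℂ f 0 z‖ = ‖z‖ := fun z => by
    let t : ℂ := ((‖z‖ + 1)⁻¹ : ℝ)
    have hpos : 0 < ‖z‖ + 1 := by positivity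
    have ht : ‖t‖ = (‖z‖ + 1)⁻¹ := by
      rw [Complex.norm_real, Real.norm_of_nonneg (by positivity)]
    have ht1 : ‖t • z‖ < 1 := by
      rw [norm_smul, ht, inv_mul_lt_one₀ hpos]
      linarith
    have h1 := hn _ ht1
    rw [eq_fderiv_of_norm_eq hf hn ht1, map_smul, norm_smul, norm_smul] at h1
    exact mul_left_cancel₀ (by rw [ht]; positivity) h1
  rw [eq_fderiv_of_norm_eq hf hn hz, eq_fderiv_of_norm_eq hf hn hw]
  exact LinearIsometry.inner_map_map ⟨(fderiv ℂ f 0 : E →ₗ[ℂ] E), hL⟩ w z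

theorem IsBiholomorphic.norm_apply_le {Φ : UnitBall ι ≃ UnitBall ι} (hΦ : IsBiholomorphic Φ)
    {a : UnitBall ι} (ha : (a : HilbertCd ι) = 0) (hΦa : (Φ a : HilbertCd ι) = 0)
    (z : UnitBall ι) : ‖(Φ z : HilbertCd ι)‖ ≤ ‖(z : HilbertCd ι)‖ := by
  obtain ⟨⟨f, hf, hf'⟩, -⟩ := hΦ
  have := Complex.norm_le_norm_of_mapsTo_ball hf (fun x hx => by
    rw [hf' ⟨x, hx⟩]
    exact Metric.ball_subset_closedBall (Φ ⟨x, hx⟩).2) (by rw [← ha, hf', hΦa, ha])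
    (mem_ball_zero_iff.mp z.2)
  rwa [hf'] at this

/-- Cartan's argument: precomposing with a Möbius map makes the automorphism fix the origin; the
Schwarz lemma for it and for its inverse shows that it preserves norms, so it preserves inner
products. The Möbius map is an involution and can be composed away again. -/
theorem IsBiholomorphic.preservesKernel {Φ : UnitBall ι ≃ UnitBall ι} (hΦ : IsBiholomorphic Φ) :
    PreservesKernel Φ := by
  let o : UnitBall ι := ⟨0, by simp⟩
  let a : UnitBall ι := Φ.symm o
  let Ψ := (moebius a).trans Φ
  have hΨ : IsBiholomorphic Ψ := (isBiholomorphic_moebius a).trans hΦ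
  have hmo : moebius a o = a := Subtype.ext (elemAut_zero _)
  have hΨo : Ψ o = o := by simp [Ψ, hmo, a]
  have hΨo' : Ψ.symm o = o := by rw [Equiv.symm_apply_eq, hΨo]
  have hn : ∀ z, ‖(Ψ z : HilbertCd ι)‖ = ‖(z : HilbertCd ι)‖ := fun z => by
    refine le_antisymm (hΨ.norm_apply_le (a := o) rfl (by rw [hΨo]) z) ?_
    simpa using hΨ.symm.norm_apply_le (a := o) rfl (by rw [hΨo']) (Ψ z)
  have hk : PreservesKernel Ψ := by
    obtain ⟨⟨f, hf, hf'⟩, -⟩ := hΨ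
    refine ⟨fun _ => 1, fun z w => ?_⟩
    rw [← hf', ← hf', inner_eq_of_norm_eq hf (fun x hx => by
      rw [hf' ⟨x, mem_ball_zero_iff.mpr hx⟩, hn]) (mem_ball_zero_iff.mp z.2)
      (mem_ball_zero_iff.mp w.2)]
    simp
  have h2 := hk.comp (preservesKernel_moebius a)
  convert h2 using 1
  ext z
  simp [Ψ, moebius_moebius]

end MoebiusMaps

/-! ### Row multipliers and interpolation on the Drury–Arveson space. -/

section DruryArvesonSpace

variable {ι : Type*}

theorem HasSum.of_forall_eq {α β : Type*} [AddCommMonoid α] [TopologicalSpace α] {f g : β → α}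
    {a : α} (hf : HasSum f a) (h : ∀ i, f i = g i) : HasSum g a :=
  (funext h : f = g) ▸ hf

theorem inner_kerAt {X H : Type*} [NormedAddCommGroup H] [InnerProductSpace ℂ H]
    [CompleteSpace H] [RKHS ℂ H X ℂ] (x : X) (h : H) : inner ℂ (kerAt H x) h = h x := by
  simp [kerAt]

theorem kerAt_druryArveson_apply (x y : UnitBall ι) :
    kerAt (DruryArveson ι) x y = (1 - inner ℂ (x : HilbertCd ι) (y : HilbertCd ι) : ℂ)⁻¹ := by
  rw [kerAt, RKHS.kerFun_apply, kernel_druryArveson]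
  simp [daKernel]

theorem inner_kerAt_kerAt (x y : UnitBall ι) :
    inner ℂ (kerAt (DruryArveson ι) x) (kerAt (DruryArveson ι) y) =
      (1 - inner ℂ (y : HilbertCd ι) (x : HilbertCd ι) : ℂ)⁻¹ := by
  rw [inner_kerAt, kerAt_druryArveson_apply]

theorem denseRange_linearCombination_kerAt : DenseRange
    (Finsupp.linearCombination ℂ (fun x : UnitBall ι => kerAt (DruryArveson ι) x)) := by
  rw [DenseRange, ← LinearMap.coe_range, Finsupp.range_linearCombination,
    Submodule.dense_iff_topologicalClosure_eq_top, Submodule.topologicalClosure_eq_top_iff,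
    Submodule.eq_bot_iff]
  intro h hh
  refine RKHS.ext fun x => ?_
  rw [← inner_kerAt, RKHS.coe_zero, Pi.zero_apply]
  exact (Submodule.mem_orthogonal _ _).mp hh _ (Submodule.subset_span ⟨x, rfl⟩)

/-- The elementary tensor `v ⊗ h` in `ℓ²(ι) ⊗ H = ⨁_i H`. -/
def elemTensor {H : Type*} [NormedAddCommGroup H] [InnerProductSpace ℂ H]
    (v : HilbertCd ι) (h : H) : lp (fun _ : ι => H) 2 :=
  ⟨fun i => v i • h, by
    have := (memℓp_gen_iff (by norm_num)).mp (lp.memℓp v)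
    refine memℓp_gen ?_
    simpa [norm_smul, mul_pow] using this.mul_right (‖h‖ ^ 2)⟩

section
variable {H : Type*} [NormedAddCommGroup H] [InnerProductSpace ℂ H]

theorem elemTensor_apply (v : HilbertCd ι) (h : H) (i : ι) : elemTensor v h i = v i • h := rfl

theorem inner_elemTensor (v w : HilbertCd ι) (h k : H) :
    inner ℂ (elemTensor v h) (elemTensor w k) = inner ℂ v w * inner ℂ h k := by
  have h1 := (lp.hasSum_inner (𝕜 := ℂ) v w).mul_right (inner ℂ h k)
  refine (lp.hasSum_inner (𝕜 := ℂ) (elemTensor v h) (elemTensor w k)).unique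
    (h1.of_forall_eq fun i => ?_)
  simp [elemTensor_apply, inner_smul_left, inner_smul_right]
  ring

theorem norm_elemTensor (v : HilbertCd ι) (h : H) : ‖elemTensor v h‖ = ‖v‖ * ‖h‖ := by
  have h1 := inner_elemTensor v v h h
  simp only [inner_self_eq_norm_sq_to_K, Complex.coe_algebraMap] at h1
  rw [← sq_eq_sq₀ (norm_nonneg _) (by positivity), mul_pow]
  exact_mod_cast h1

theorem elemTensor_add (v : HilbertCd ι) (h k : H) :
    elemTensor v (h + k) = elemTensor v h + elemTensor v k := by
  exact Subtype.ext (funext fun i => smul_add _ _ _)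

theorem elemTensor_smul (v : HilbertCd ι) (c : ℂ) (h : H) :
    elemTensor v (c • h) = c • elemTensor v h := by
  exact Subtype.ext (funext fun i => smul_comm _ _ _)

/-- The operator `h ↦ v ⊗ h`. -/
def elemTensorL (v : HilbertCd ι) : H →L[ℂ] lp (fun _ : ι => H) 2 :=
  LinearMap.mkContinuous ⟨⟨elemTensor v, elemTensor_add v⟩, elemTensor_smul v⟩ ‖v‖
    fun h => (norm_elemTensor v h).le

theorem elemTensorL_apply (v : HilbertCd ι) (h : H) : elemTensorL v h = elemTensor v h := rfl

theorem norm_elemTensorL_le (v : HilbertCd ι) : ‖(elemTensorL v : H →L[ℂ] _)‖ ≤ ‖v‖ :=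
  LinearMap.mkContinuous_norm_le _ (norm_nonneg _) _

theorem inner_star_star (v w : HilbertCd ι) : inner ℂ (star v) (star w) = (inner ℂ w v : ℂ) := by
  refine (lp.hasSum_inner (𝕜 := ℂ) (star v) (star w)).unique
    ((lp.hasSum_inner (𝕜 := ℂ) w v).of_forall_eq fun i => ?_)
  simp [mul_comm]

theorem norm_star_hilbertCd (v : HilbertCd ι) : ‖star v‖ = ‖v‖ := norm_star v

end

theorem hasSum_inner_elemTensor_star (v : HilbertCd ι) (h : lp (fun _ : ι => DruryArveson ι) 2)
    (z : UnitBall ι) :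
    HasSum (fun i => v i * (h i : DruryArveson ι) z)
      (inner ℂ (elemTensor (star v) (kerAt (DruryArveson ι) z)) h) := by
  refine (lp.hasSum_inner (𝕜 := ℂ) (elemTensor (star v)
    (kerAt (DruryArveson ι) z)) h).of_forall_eq fun i => ?_
  simp [elemTensor_apply, inner_smul_left, inner_kerAt]

/-- Row multipliers are recognised by their adjoints on kernel functions. The coordinatewise
conjugation `star` compensates for the conjugate-linear first slot of the inner product. -/
theorem isRowMultOp_adjoint {F : UnitBall ι → HilbertCd ι}
    {R : DruryArveson ι →L[ℂ] lp (fun _ : ι => DruryArveson ι) 2}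
    (hR : ∀ z, R (kerAt (DruryArveson ι) z) =
      elemTensor (star (F z)) (kerAt (DruryArveson ι) z)) :
    IsRowMultOp F (ContinuousLinearMap.adjoint R) := fun h z => by
  rw [← inner_kerAt, ContinuousLinearMap.adjoint_inner_right, hR]
  exact hasSum_inner_elemTensor_star _ _ _

theorem IsRowMultOp.adjoint_kerAt {F : UnitBall ι → HilbertCd ι}
    {M : lp (fun _ : ι => DruryArveson ι) 2 →L[ℂ] DruryArveson ι} (hM : IsRowMultOp F M)
    (z : UnitBall ι) : ContinuousLinearMap.adjoint M (kerAt (DruryArveson ι) z) =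
      elemTensor (star (F z)) (kerAt (DruryArveson ι) z) := by
  refine ext_inner_right ℂ fun h => ?_
  rw [ContinuousLinearMap.adjoint_inner_left, inner_kerAt]
  exact (hM h z).unique (hasSum_inner_elemTensor_star _ _ _)

/-- The adjoint is prescribed on the kernel functions, whose span is dense; the norm inequality
makes this well defined and extends it with the same bound. -/
theorem exists_isRowMultOp_of_norm_le {F : UnitBall ι → HilbertCd ι} {C : ℝ} (hC : 0 ≤ C)
    (h : ∀ v : UnitBall ι →₀ ℂ,
      ‖Finsupp.linearCombination ℂ
        (fun z => elemTensor (star (F z)) (kerAt (DruryArveson ι) z)) v‖ ≤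
      C * ‖Finsupp.linearCombination ℂ (fun z => kerAt (DruryArveson ι) z) v‖) :
    ∃ M, IsRowMultOp F M ∧ ‖M‖ ≤ C := by
  let R := LinearMap.extendOfNorm (Finsupp.linearCombination ℂ
    (fun z => elemTensor (star (F z)) (kerAt (DruryArveson ι) z)))
    (Finsupp.linearCombination ℂ (fun z => kerAt (DruryArveson ι) z))
  have hd := denseRange_linearCombination_kerAt (ι := ι)
  refine ⟨ContinuousLinearMap.adjoint R, isRowMultOp_adjoint fun z => ?_, ?_⟩
  · have := LinearMap.extendOfNorm_eq hd ⟨C, h⟩ (Finsupp.single z 1)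
    simpa only [Finsupp.linearCombination_single, one_smul] using this
  · rw [LinearIsometryEquiv.norm_map]
    exact R.opNorm_le_bound hC (LinearMap.norm_extendOfNorm_apply_le hd C h)

/-- The kernel `(1 - ⟨Φ z, Φ w⟩) / (1 - ⟨z, w⟩) = g(z) conj(g w)` is positive of rank one, so the
defect in the norm inequality is a single square. -/
theorem PreservesKernel.exists_isRowMultOp {Φ : UnitBall ι → UnitBall ι}
    (hΦ : PreservesKernel Φ) :
    ∃ M, IsRowMultOp (fun z => (Φ z : HilbertCd ι)) M ∧ ‖M‖ ≤ 1 := by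
  obtain ⟨g, hg⟩ := hΦ
  refine exists_isRowMultOp_of_norm_le zero_le_one fun v => ?_
  rw [one_mul]
  have key : (inner ℂ (Finsupp.linearCombination ℂ
        (fun z => elemTensor (star (Φ z : HilbertCd ι)) (kerAt (DruryArveson ι) z)) v)
      (Finsupp.linearCombination ℂ
        (fun z => elemTensor (star (Φ z : HilbertCd ι)) (kerAt (DruryArveson ι) z)) v) : ℂ) =
      inner ℂ (Finsupp.linearCombination ℂ (fun z => kerAt (DruryArveson ι) z) v)
        (Finsupp.linearCombination ℂ (fun z => kerAt (DruryArveson ι) z) v) -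
      conj (v.sum fun z c => c * conj (g z)) * (v.sum fun z c => c * conj (g z)) := by
    simp only [Finsupp.linearCombination_apply, Finsupp.sum, sum_inner, inner_sum,
      inner_smul_left, inner_smul_right, inner_elemTensor, inner_star_star, inner_kerAt_kerAt,
      map_sum, Finset.sum_mul, map_mul, Finset.mul_sum,
      ← Finset.sum_sub_distrib]
    refine Finset.sum_congr rfl fun z _ => Finset.sum_congr rfl fun w _ => ?_
    have h3 := UnitBall.one_sub_inner_ne_zero z w
    have e : (inner ℂ (Φ z : HilbertCd ι) (Φ w : HilbertCd ι) : ℂ) =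
      1 - g w * conj (g z) * (1 - inner ℂ (z : HilbertCd ι) (w : HilbertCd ι)) := by
      rw [← hg w z]; ring
    rw [e]
    simp only [RingHomCompTriple.comp_apply, RingHom.id_apply]
    field_simp
  rw [inner_self_eq_norm_sq_to_K, inner_self_eq_norm_sq_to_K, Complex.conj_mul'] at key
  simp only [Complex.coe_algebraMap] at key
  refine le_of_sq_le_sq ?_ (norm_nonneg _)
  have key' : ‖Finsupp.linearCombination ℂ
        (fun z => elemTensor (star (Φ z : HilbertCd ι)) (kerAt (DruryArveson ι) z)) v‖ ^ 2 =
      ‖Finsupp.linearCombination ℂ (fun z => kerAt (DruryArveson ι) z) v‖ ^ 2 -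
      ‖v.sum fun z c => c * conj (g z)‖ ^ 2 := by exact_mod_cast key
  rw [key']
  nlinarith [norm_nonneg (v.sum fun z c => c * conj (g z))]

/-- The function `f` is a multiplier of the Drury-Arveson space of norm at most `C`. -/
def IsMultiplierOfBound (f : UnitBall ι → ℂ) (C : ℝ) : Prop :=
  ∃ M : DruryArveson ι →L[ℂ] DruryArveson ι,
    (∀ (h : DruryArveson ι) (z : UnitBall ι), M h z = f z * h z) ∧ ‖M‖ ≤ C

theorem IsMultiplierOfBound.mono {f : UnitBall ι → ℂ} {C D : ℝ} (hf : IsMultiplierOfBound f C)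
    (h : C ≤ D) : IsMultiplierOfBound f D :=
  let ⟨M, hM, hC⟩ := hf
  ⟨M, hM, hC.trans h⟩

theorem isMultiplierOfBound_const (c : ℂ) :
    IsMultiplierOfBound (fun _ : UnitBall ι => c) ‖c‖ :=
  ⟨c • ContinuousLinearMap.id ℂ _, fun h z => by simp,
    (norm_smul_le _ _).trans (mul_le_of_le_one_right (norm_nonneg _)
      ContinuousLinearMap.norm_id_le)⟩

theorem IsMultiplierOfBound.mul {f g : UnitBall ι → ℂ} {C D : ℝ} (hf : IsMultiplierOfBound f C)
    (hg : IsMultiplierOfBound g D) : IsMultiplierOfBound (fun z => f z * g z) (C * D) :=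
  let ⟨M, hM, hC⟩ := hf
  let ⟨N, hN, hD⟩ := hg
  ⟨M ∘L N, fun h z => by simp [hM, hN, mul_assoc], (M.opNorm_comp_le N).trans
    (mul_le_mul hC hD (norm_nonneg _) ((norm_nonneg _).trans hC))⟩

theorem IsMultiplierOfBound.sub {f g : UnitBall ι → ℂ} {C D : ℝ} (hf : IsMultiplierOfBound f C)
    (hg : IsMultiplierOfBound g D) : IsMultiplierOfBound (fun z => f z - g z) (C + D) :=
  let ⟨M, hM, hC⟩ := hf
  let ⟨N, hN, hD⟩ := hg
  ⟨M - N, fun h z => by simp [hM, hN, sub_mul], (norm_sub_le _ _).trans (add_le_add hC hD)⟩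

theorem IsMultiplierOfBound.prod {α : Type*} (s : Finset α) {f : α → UnitBall ι → ℂ} {C : ℝ}
    (hf : ∀ i ∈ s, IsMultiplierOfBound (f i) C) :
    IsMultiplierOfBound (fun z => ∏ i ∈ s, f i z) (C ^ s.card) := by
  classical
  induction s using Finset.induction_on with
  | empty => simpa using isMultiplierOfBound_const (ι := ι) 1
  | insert i s hi ih =>
    simp only [Finset.prod_insert hi, Finset.card_insert_of_notMem hi, pow_succ']
    exact (hf i (Finset.mem_insert_self _ _)).mul
      (ih fun j hj => hf j (Finset.mem_insert_of_mem hj))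

theorem PreservesKernel.isMultiplierOfBound_inner {Φ : UnitBall ι → UnitBall ι}
    (hΦ : PreservesKernel Φ) (v : HilbertCd ι) :
    IsMultiplierOfBound (fun z => inner ℂ v (Φ z : HilbertCd ι)) ‖v‖ := by
  obtain ⟨M, hM, hM1⟩ := hΦ.exists_isRowMultOp
  refine ⟨M ∘L elemTensorL (star v), fun h z => ?_, ?_⟩
  · refine (hM (elemTensor (star v) h) z).unique ?_
    refine ((lp.hasSum_inner (𝕜 := ℂ) v (Φ z : HilbertCd ι)).mul_right
      (h z)).of_forall_eq fun i => ?_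
    simp [elemTensor_apply]
    ring
  · refine (M.opNorm_comp_le _).trans ?_
    have := norm_elemTensorL_le (H := DruryArveson ι) (star v)
    rw [norm_star_hilbertCd] at this
    exact (mul_le_mul hM1 this (ContinuousLinearMap.opNorm_nonneg _) zero_le_one).trans_eq (one_mul _)

theorem IsMultiplierOfBound.exists_isRowMultOp {p : UnitBall ι → ℂ} {C : ℝ}
    (hp : IsMultiplierOfBound p C) (v : HilbertCd ι) :
    ∃ M, IsRowMultOp (fun z => p z • v) M ∧ ‖M‖ ≤ C * ‖v‖ := by
  obtain ⟨N, hN, hNC⟩ := hp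
  refine ⟨N ∘L ContinuousLinearMap.adjoint (elemTensorL (star v)), fun h z => ?_, ?_⟩
  · rw [ContinuousLinearMap.comp_apply, hN, ← inner_kerAt z (ContinuousLinearMap.adjoint _ _),
      ContinuousLinearMap.adjoint_inner_right, elemTensorL_apply]
    refine ((hasSum_inner_elemTensor_star v h z).mul_left (p z)).of_forall_eq fun i => ?_
    simp [mul_assoc]
  · refine (N.opNorm_comp_le _).trans ?_
    rw [LinearIsometryEquiv.norm_map]
    have := norm_elemTensorL_le (H := DruryArveson ι) (star v)
    rw [norm_star_hilbertCd] at this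
    exact mul_le_mul hNC this (norm_nonneg _) ((norm_nonneg _).trans hNC)

theorem IsRowMultOp.add {F G : UnitBall ι → HilbertCd ι}
    {M N : lp (fun _ : ι => DruryArveson ι) 2 →L[ℂ] DruryArveson ι} (hM : IsRowMultOp F M)
    (hN : IsRowMultOp G N) : IsRowMultOp (fun z => F z + G z) (M + N) := fun h z => by
  simpa [add_mul] using (hM h z).add (hN h z)

theorem isRowMultOp_zero : IsRowMultOp (fun _ : UnitBall ι => (0 : HilbertCd ι)) 0 :=
  fun h z => by simp [hasSum_zero]

/-- A multiplier of controlled norm which is one where `Φ` takes the value `x`, and zero where `Φ`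
takes another value in `S`. -/
theorem PreservesKernel.exists_interpolating {Φ : UnitBall ι → UnitBall ι}
    (hΦ : PreservesKernel Φ) (S : Finset (UnitBall ι)) (x : UnitBall ι) {δ : ℝ} (hδ : 0 < δ)
    (hδ2 : δ ≤ 2) (hS : ∀ y ∈ S, y ≠ x → δ ≤ ‖(x : HilbertCd ι) - y‖) :
    ∃ p : UnitBall ι → ℂ, IsMultiplierOfBound p ((2 / δ) ^ S.card) ∧
      (∀ z, Φ z = x → p z = 1) ∧ ∀ y ∈ S, y ≠ x → ∀ z, Φ z = y → p z = 0 := by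
  classical
  let v : UnitBall ι → HilbertCd ι := fun y => (x : HilbertCd ι) - y
  -- `f y` is the affine functional `⟨Φ z - y, x - y⟩ / ‖x - y‖²`: it is `1` where `Φ z = x` and `0`
  -- where `Φ z = y`, with multiplier norm at most `2 / ‖x - y‖`.
  let f : UnitBall ι → UnitBall ι → ℂ := fun y z =>
    ((‖v y‖ : ℂ) ^ 2)⁻¹ * (inner ℂ (v y) (Φ z : HilbertCd ι) - inner ℂ (v y) (y : HilbertCd ι))
  -- The assumption `δ ≤ 2` allows the number of factors to be rounded up to `S.card`.
  have h1 : 1 ≤ 2 / δ := (one_le_div hδ).mpr hδ2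
  refine ⟨fun z => ∏ y ∈ S.erase x, f y z, ?_, fun z hz => ?_, fun y hy hyx z hz => ?_⟩
  · refine (IsMultiplierOfBound.prod (S.erase x) (C := 2 / δ) fun y hy => ?_).mono
      (pow_le_pow_right₀ h1 (Finset.card_le_card (Finset.erase_subset _ _)))
    have hy' := hS y (Finset.mem_of_mem_erase hy) (Finset.ne_of_mem_erase hy)
    have hv : 0 < ‖v y‖ := hδ.trans_le hy'
    refine ((isMultiplierOfBound_const _).mul ((hΦ.isMultiplierOfBound_inner (v y)).sub
      (isMultiplierOfBound_const _))).mono ?_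
    have hin : ‖(inner ℂ (v y) (y : HilbertCd ι) : ℂ)‖ ≤ ‖v y‖ :=
      (norm_inner_le_norm _ _).trans
        (mul_le_of_le_one_right hv.le (mem_ball_zero_iff.mp y.2).le)
    calc _ = (‖v y‖ ^ 2)⁻¹ * (‖v y‖ + ‖(inner ℂ (v y) (y : HilbertCd ι) : ℂ)‖) := by simp
      _ ≤ (‖v y‖ ^ 2)⁻¹ * (‖v y‖ + ‖v y‖) := by gcongr
      _ = 2 / ‖v y‖ := by rw [← two_mul]; field_simp
      _ ≤ 2 / δ := by gcongr
  · refine Finset.prod_eq_one fun y hy => ?_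
    have hy' := hS y (Finset.mem_of_mem_erase hy) (Finset.ne_of_mem_erase hy)
    have hv : (‖v y‖ : ℂ) ≠ 0 := by exact_mod_cast (hδ.trans_le hy').ne'
    simp only [f, hz, ← inner_sub_right]
    rw [show (x : HilbertCd ι) - y = v y from rfl, inner_self_eq_norm_sq_to_K]
    simp only [Complex.coe_algebraMap]
    field_simp
  · refine Finset.prod_eq_zero (Finset.mem_erase.mpr ⟨hyx, hy⟩) ?_
    simp [f, hz]

theorem preservesKernel_id : PreservesKernel (id : UnitBall ι → UnitBall ι) :=
  ⟨fun _ => 1, fun z w => by simp⟩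

end DruryArvesonSpace

/-! ### Matrices of operators and row operators. -/

section OperatorMatrices

theorem opMatrix_apply {H : Type*} [NormedAddCommGroup H] [InnerProductSpace ℂ H] {m : ℕ}
    (A : Matrix (Fin m) (Fin m) (H →L[ℂ] H)) (h : PiLp 2 (fun _ : Fin m => H)) (i : Fin m) :
    opMatrix A h i = ∑ j, A i j (h j) := by
  simp [opMatrix]

variable {H K : Type*} [NormedAddCommGroup H] [InnerProductSpace ℂ H]
  [NormedAddCommGroup K] [InnerProductSpace ℂ K]

/-- The diagonal operator `S ⊕ ⋯ ⊕ S`. -/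
def diagOp (m : ℕ) (S : H →L[ℂ] K) :
    PiLp 2 (fun _ : Fin m => H) →L[ℂ] PiLp 2 (fun _ : Fin m => K) :=
  ((PiLp.continuousLinearEquiv 2 ℂ (fun _ : Fin m => K)).symm :
      (Fin m → K) →L[ℂ] PiLp 2 (fun _ : Fin m => K)) ∘L
    ContinuousLinearMap.pi (fun i => S ∘L PiLp.proj 2 (fun _ : Fin m => H) i)

theorem diagOp_apply {m : ℕ} (S : H →L[ℂ] K) (h : PiLp 2 (fun _ : Fin m => H)) (i : Fin m) :
    diagOp m S h i = S (h i) := by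
  simp [diagOp]

theorem norm_diagOp_le (m : ℕ) (S : H →L[ℂ] K) : ‖diagOp m S‖ ≤ ‖S‖ := by
  refine ContinuousLinearMap.opNorm_le_bound _ (norm_nonneg _) fun h => ?_
  refine le_of_sq_le_sq ?_ (by positivity)
  rw [mul_pow, PiLp.norm_sq_eq_of_L2, PiLp.norm_sq_eq_of_L2, Finset.mul_sum]
  refine Finset.sum_le_sum fun i _ => ?_
  rw [diagOp_apply, ← mul_pow]
  gcongr
  exact S.le_opNorm _

theorem opMatrix_conj {m : ℕ} (A : Matrix (Fin m) (Fin m) (H →L[ℂ] H)) (S : H →L[ℂ] K)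
    (R : K →L[ℂ] H) :
    opMatrix (A.map fun M => S ∘L M ∘L R) = diagOp m S ∘L opMatrix A ∘L diagOp m R := by
  refine ContinuousLinearMap.ext fun h => PiLp.ext fun i => ?_
  simp [opMatrix_apply, diagOp_apply]

/-- The bound is independent of `m`, which is what complete boundedness of a conjugation requires.
-/
theorem enorm_opMatrix_conj_le {m : ℕ} (A : Matrix (Fin m) (Fin m) (H →L[ℂ] H)) (S : H →L[ℂ] K)
    (R : K →L[ℂ] H) :
    ‖opMatrix (A.map fun M => S ∘L M ∘L R)‖ₑ ≤ ‖S‖ₑ * ‖R‖ₑ * ‖opMatrix A‖ₑ := by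
  rw [opMatrix_conj]
  simp only [← ofReal_norm]
  rw [← ENNReal.ofReal_mul (norm_nonneg _), ← ENNReal.ofReal_mul (by positivity)]
  refine ENNReal.ofReal_le_ofReal ?_
  calc _ ≤ ‖diagOp m S‖ * (‖opMatrix A‖ * ‖diagOp m R‖) :=
        (ContinuousLinearMap.opNorm_comp_le _ _).trans
          (by gcongr; exact ContinuousLinearMap.opNorm_comp_le _ _)
    _ ≤ ‖S‖ * (‖opMatrix A‖ * ‖R‖) := by
        gcongr
        · exact norm_diagOp_le m S
        · exact norm_diagOp_le m R
    _ = _ := by ring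

/-- The matrix with first row `M` and other rows zero. -/
def firstRow {m : ℕ} {α : Type*} [Zero α] (M : Fin m → α) : Matrix (Fin m) (Fin m) α :=
  Matrix.of fun i j => if i.1 = 0 then M j else 0

theorem firstRow_map {m : ℕ} {α β : Type*} [Zero α] [Zero β] (M : Fin m → α) (f : α → β)
    (hf : f 0 = 0) : (firstRow M).map f = firstRow (fun j => f (M j)) := by
  ext i j : 1
  simp only [firstRow, Matrix.map_apply, Matrix.of_apply]
  split_ifs
  · rfl
  · exact hf

/-- Rows are padded to square matrices because `cbNorm` tests square matrices only; the padding does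
not affect norms. -/
theorem norm_opMatrix_firstRow_apply {m : ℕ} (M : Fin m → H →L[ℂ] H)
    (h : PiLp 2 (fun _ : Fin m => H)) :
    ‖opMatrix (firstRow M) h‖ = ‖∑ j, M j (h j)‖ := by
  refine (sq_eq_sq₀ (norm_nonneg _) (norm_nonneg _)).mp ?_
  rw [PiLp.norm_sq_eq_of_L2]
  cases m with
  | zero => simp
  | succ m =>
    rw [Finset.sum_eq_single 0]
    · simp [opMatrix_apply, firstRow]
    · intro i _ hi
      simp [opMatrix_apply, firstRow, hi]
    · simp

/-- The left side is `‖g‖²` for the column `g` of vectors `M_j* h`. Pairing `h` with the row applied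
to `g` gives `‖g‖² ≤ ‖h‖ c ‖g‖`. -/
theorem sum_norm_adjoint_sq_le [CompleteSpace H] {m : ℕ} (M : Fin m → H →L[ℂ] H) {c : ℝ}
    (hM : ‖opMatrix (firstRow M)‖ ≤ c) (h : H) :
    ∑ j, ‖ContinuousLinearMap.adjoint (M j) h‖ ^ 2 ≤ c ^ 2 * ‖h‖ ^ 2 := by
  let g : PiLp 2 (fun _ : Fin m => H) :=
    WithLp.toLp 2 fun j => ContinuousLinearMap.adjoint (M j) h
  have h1 : ‖g‖ ^ 2 = ∑ j, ‖ContinuousLinearMap.adjoint (M j) h‖ ^ 2 := by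
    rw [PiLp.norm_sq_eq_of_L2]
  have h2 : ‖∑ j, M j (g j)‖ ≤ c * ‖g‖ := by
    rw [← norm_opMatrix_firstRow_apply]
    exact ContinuousLinearMap.le_of_opNorm_le _ hM g
  have h3 : (‖g‖ : ℂ) ^ 2 = inner ℂ h (∑ j, M j (g j)) := by
    rw [inner_sum, ← Complex.ofReal_pow, h1, Complex.ofReal_sum]
    refine Finset.sum_congr rfl fun j _ => ?_
    rw [← ContinuousLinearMap.adjoint_inner_left]
    change _ = inner ℂ _ (ContinuousLinearMap.adjoint (M j) h)
    rw [inner_self_eq_norm_sq_to_K]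
    simp
  have h4 : ‖g‖ ^ 2 ≤ ‖h‖ * (c * ‖g‖) := by
    have := congrArg norm h3
    rw [norm_pow, Complex.norm_real, norm_norm] at this
    rw [this]
    exact (norm_inner_le_norm _ _).trans (by gcongr)
  rw [← h1, ← mul_pow]
  have hc : 0 ≤ c := (norm_nonneg _).trans hM
  rcases (norm_nonneg g).eq_or_lt with h0 | h0
  · rw [← h0, zero_pow two_ne_zero]
    positivity
  · have : ‖g‖ ≤ c * ‖h‖ := le_of_mul_le_mul_right (by nlinarith) h0
    gcongr

end OperatorMatrices

/-! ### Multiplier algebras and their isomorphisms. -/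

section MultiplierAlgebras

variable {X₁ X₂ : Type*} {H₁ H₂ : Type*}
  [NormedAddCommGroup H₁] [InnerProductSpace ℂ H₁] [RKHS ℂ H₁ X₁ ℂ]
  [NormedAddCommGroup H₂] [InnerProductSpace ℂ H₂] [RKHS ℂ H₂ X₂ ℂ]

theorem multOp_eq (f : MultAlg H₁) (M : H₁ →L[ℂ] H₁) (hM : ∀ h x, M h x = f.1 x * h x) :
    multOp f = M :=
  ContinuousLinearMap.ext fun h => RKHS.ext fun x => by rw [multOp_apply, hM]

theorem multOp_one : multOp (1 : MultAlg H₁) = ContinuousLinearMap.id ℂ H₁ :=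
  multOp_eq _ _ fun h x => by simp

theorem multOp_zero : multOp (0 : MultAlg H₁) = 0 :=
  multOp_eq _ _ fun h x => by simp

theorem adjoint_multOp_kerAt [CompleteSpace H₁] (f : MultAlg H₁) (x : X₁) :
    ContinuousLinearMap.adjoint (multOp f) (kerAt H₁ x) = conj (f.1 x) • kerAt H₁ x := by
  refine ext_inner_right ℂ fun h => ?_
  rw [ContinuousLinearMap.adjoint_inner_left, inner_kerAt, multOp_apply, inner_smul_left,
    inner_kerAt, Complex.conj_conj]

theorem multMatrixNorm_one (H : Type*) {X : Type*} [NormedAddCommGroup H]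
    [InnerProductSpace ℂ H] [RKHS ℂ H X ℂ] [Nontrivial H] :
    multMatrixNorm (1 : Matrix (Fin 1) (Fin 1) (MultAlg H)) = 1 := by
  have : opMatrix ((1 : Matrix (Fin 1) (Fin 1) (MultAlg H)).map multOp) =
      ContinuousLinearMap.id ℂ _ := by
    refine ContinuousLinearMap.ext fun h => PiLp.ext fun i => ?_
    rw [opMatrix_apply]
    simp [Subsingleton.elim i 0, multOp_one]
  rw [multMatrixNorm, this]
  have : Nontrivial (PiLp 2 (fun _ : Fin 1 => H)) :=
    (WithLp.equiv 2 (Fin 1 → H)).nontrivial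
  rw [← ofReal_norm, ContinuousLinearMap.norm_id, ENNReal.ofReal_one]

/-- A unital map fixes the `1 × 1` identity matrix, which has norm one on a nonzero space. -/
theorem one_le_cbNorm [Nontrivial H₁] [Nontrivial H₂] (φ : MultAlg H₁ ≃ₐ[ℂ] MultAlg H₂) :
    1 ≤ cbNorm φ.toLinearMap := by
  refine le_iSup_of_le 1 (le_iSup_of_le 1 (le_iSup_of_le (multMatrixNorm_one H₁).le ?_))
  have : (1 : Matrix (Fin 1) (Fin 1) (MultAlg H₁)).map φ.toLinearMap = 1 :=
    Matrix.map_one _ (map_zero _) (map_one φ)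
  rw [this, multMatrixNorm_one]

theorem one_le_cbDistortion [Nontrivial H₁] [Nontrivial H₂] (φ : MultAlg H₁ ≃ₐ[ℂ] MultAlg H₂) :
    1 ≤ cbDistortion φ :=
  one_le_mul (one_le_cbNorm φ) (one_le_cbNorm φ.symm)

theorem one_le_deltaAlg [Nontrivial H₁] [Nontrivial H₂] : 1 ≤ deltaAlg H₁ H₂ :=
  le_iInf one_le_cbDistortion

theorem deltaAlg_le_deltaM : deltaAlg H₁ H₂ ≤ deltaM H₁ H₂ :=
  le_iInf fun φ => le_iInf fun _ => iInf_le _ φ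

theorem one_le_deltaRK [CompleteSpace H₁] [CompleteSpace H₂] [Nontrivial H₁] :
    1 ≤ deltaRK H₁ H₂ := by
  refine le_iInf fun T => le_iInf fun _ => ?_
  have h1 : ‖(T.symm : H₂ →L[ℂ] H₁) ∘L (T : H₁ →L[ℂ] H₂)‖ = 1 := by
    rw [ContinuousLinearEquiv.coe_symm_comp_coe, ContinuousLinearMap.norm_id]
  have h2 := ContinuousLinearMap.opNorm_comp_le (T.symm : H₂ →L[ℂ] H₁) (T : H₁ →L[ℂ] H₂)
  rw [h1] at h2
  rw [← ofReal_norm, ← ofReal_norm, ← ENNReal.ofReal_mul (norm_nonneg _),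
    ENNReal.one_le_ofReal, mul_comm]
  exact h2

theorem cbNorm_le_of_conj (φ : MultAlg H₁ →ₗ[ℂ] MultAlg H₂) (S : H₁ →L[ℂ] H₂) (R : H₂ →L[ℂ] H₁)
    (h : ∀ f, multOp (φ f) = S ∘L multOp f ∘L R) : cbNorm φ ≤ ‖S‖ₑ * ‖R‖ₑ := by
  refine iSup_le fun m => iSup_le fun A => iSup_le fun hA => ?_
  have : (A.map φ).map multOp = (A.map multOp).map fun M => S ∘L M ∘L R := by
    ext i j : 1
    exact h _
  rw [multMatrixNorm, this]
  exact (enorm_opMatrix_conj_le _ S R).trans (mul_le_of_le_one_right zero_le hA)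

/-- The adjoint of a map that permutes kernel functions up to scalars is a weighted composition
operator. -/
theorem apply_of_isRKHSIso [CompleteSpace H₁] [CompleteSpace H₂] {T : H₁ →L[ℂ] H₂}
    {F : X₁ → X₂} {c : X₁ → ℂ} (hT : ∀ x, T (kerAt H₁ x) = c x • kerAt H₂ (F x)) (h : H₂)
    (x : X₁) : ContinuousLinearMap.adjoint T h x = conj (c x) * h (F x) := by
  rw [← inner_kerAt, ContinuousLinearMap.adjoint_inner_right, hT, inner_smul_left, inner_kerAt]

theorem enorm_adjoint [CompleteSpace H₁] [CompleteSpace H₂] (T : H₁ →L[ℂ] H₂) :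
    ‖ContinuousLinearMap.adjoint T‖ₑ = ‖T‖ₑ := by
  rw [← ofReal_norm, ← ofReal_norm, LinearIsometryEquiv.norm_map]

/-- Take `M_f ↦ (T⁻¹)* M_f T*`: the weights of the two composition operators cancel and
multiplication by `f ∘ F⁻¹` remains. Both this map and its inverse have cb norm at most `‖T‖ ‖T⁻¹‖`,
whence the square. -/
theorem IsRKHSIso.exists_isMultIso [CompleteSpace H₁] [CompleteSpace H₂] {T : H₁ ≃L[ℂ] H₂}
    (hT : IsRKHSIso T) : ∃ φ : MultAlg H₁ ≃ₐ[ℂ] MultAlg H₂, IsMultIso φ ∧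
      cbDistortion φ ≤ (‖(T : H₁ →L[ℂ] H₂)‖ₑ * ‖(T.symm : H₂ →L[ℂ] H₁)‖ₑ) ^ 2 := by
  obtain ⟨F, c, hc, hF⟩ := hT
  have hF' : ∀ y, (T.symm : H₂ →L[ℂ] H₁) (kerAt H₂ y) =
      (c (F.symm y))⁻¹ • kerAt H₁ (F.symm y) := fun y => by
    rw [ContinuousLinearEquiv.coe_coe, ContinuousLinearEquiv.symm_apply_eq, map_smul, hF,
      smul_smul, inv_mul_cancel₀ (hc _), one_smul, Equiv.apply_symm_apply]
  have hTF : ∀ x, (T : H₁ →L[ℂ] H₂) (kerAt H₁ x) = c x • kerAt H₂ (F x) := hF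
  have h1 : ∀ (f : X₁ → ℂ) (M : H₁ →L[ℂ] H₁), (∀ h x, M h x = f x * h x) → ∀ h y,
      ((ContinuousLinearMap.adjoint (T.symm : H₂ →L[ℂ] H₁)) ∘L M ∘L
        (ContinuousLinearMap.adjoint (T : H₁ →L[ℂ] H₂))) h y = f (F.symm y) * h y := by
    intro f M hM h y
    have := (map_ne_zero (starRingEnd ℂ)).mpr (hc (F.symm y))
    rw [ContinuousLinearMap.comp_apply, ContinuousLinearMap.comp_apply,
      apply_of_isRKHSIso hF', hM, apply_of_isRKHSIso hTF, Equiv.apply_symm_apply, map_inv₀]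
    field_simp
  have h2 : ∀ (f : X₂ → ℂ) (M : H₂ →L[ℂ] H₂), (∀ h x, M h x = f x * h x) → ∀ h x,
      ((ContinuousLinearMap.adjoint (T : H₁ →L[ℂ] H₂)) ∘L M ∘L
        (ContinuousLinearMap.adjoint (T.symm : H₂ →L[ℂ] H₁))) h x = f (F x) * h x := by
    intro f M hM h x
    have := (map_ne_zero (starRingEnd ℂ)).mpr (hc x)
    rw [ContinuousLinearMap.comp_apply, ContinuousLinearMap.comp_apply,
      apply_of_isRKHSIso hTF, hM, apply_of_isRKHSIso hF', Equiv.symm_apply_apply, map_inv₀]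
    field_simp
  let φ : MultAlg H₁ ≃ₐ[ℂ] MultAlg H₂ :=
    { toFun := fun f => ⟨fun y => f.1 (F.symm y), _, h1 f.1 (multOp f) (multOp_apply f)⟩
      invFun := fun f => ⟨fun x => f.1 (F x), _, h2 f.1 (multOp f) (multOp_apply f)⟩
      left_inv := fun f => by ext x; simp
      right_inv := fun f => by ext x; simp
      map_mul' := fun f g => rfl
      map_add' := fun f g => rfl
      commutes' := fun r => rfl }
  have c1 := cbNorm_le_of_conj φ.toLinearMap _ _ fun f =>
    multOp_eq (φ f) _ (h1 f.1 (multOp f) (multOp_apply f))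
  have c2 := cbNorm_le_of_conj φ.symm.toLinearMap _ _ fun f =>
    multOp_eq (φ.symm f) _ (h2 f.1 (multOp f) (multOp_apply f))
  rw [enorm_adjoint, enorm_adjoint] at c1 c2
  refine ⟨φ, ⟨c1.trans_lt ?_, c2.trans_lt ?_, F.symm, fun f y => rfl⟩, ?_⟩
  · exact ENNReal.mul_lt_top enorm_lt_top enorm_lt_top
  · exact ENNReal.mul_lt_top enorm_lt_top enorm_lt_top
  · rw [pow_two]
    refine (mul_le_mul' c1 c2).trans_eq ?_
    ring

theorem deltaM_le_deltaRK_sq [CompleteSpace H₁] [CompleteSpace H₂] :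
    deltaM H₁ H₂ ≤ deltaRK H₁ H₂ ^ 2 := by
  -- Turning the square into a root on the left leaves a bare infimum on the right.
  rw [← ENNReal.rpow_two, ← ENNReal.rpow_inv_le_iff two_pos]
  refine le_iInf fun T => le_iInf fun hT => ?_
  rw [ENNReal.rpow_inv_le_iff two_pos, ENNReal.rpow_two]
  obtain ⟨φ, hφ, hle⟩ := hT.exists_isMultIso
  exact (iInf₂_le φ hφ).trans hle

/-- In terms of the dual functions `e x`, multiplication by `f` is the finite-rank operator `h ↦ ∑
f(x) h(x) e x`. -/
theorem mem_multAlg_of_finite [CompleteSpace H₁] [Finite X₁]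
    (he : ∀ x : X₁, ∃ e : H₁, e x = 1 ∧ ∀ y, y ≠ x → e y = 0) (f : X₁ → ℂ) :
    f ∈ MultAlg H₁ := by
  classical
  have := Fintype.ofFinite X₁
  choose e he1 he0 using he
  refine ⟨∑ x, (f x • innerSL ℂ (kerAt H₁ x)).smulRight (e x), fun h y => ?_⟩
  rw [sum_apply, ← RKHS.coeCLM_apply (𝕜 := ℂ), map_sum, Finset.sum_apply,
    Finset.sum_eq_single y]
  · simp [he1, inner_kerAt]
  · intro x _ hx
    simp [he0 x y hx.symm]
  · simp

/-- Characters of the algebra of all functions on a finite set are point evaluations. -/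
theorem exists_eval_of_algHom {X : Type*} [Finite X] {A : Subalgebra ℂ (X → ℂ)}
    (hA : ∀ f, f ∈ A) (χ : A →ₐ[ℂ] ℂ) : ∃ x, ∀ f, χ f = f.1 x := by
  classical
  have := Fintype.ofFinite X
  let e : X → A := fun x => ⟨Pi.single x 1, hA _⟩
  -- The indicators sum to `1`, so `χ` is nonzero at some `e x`; since `f * e x = f(x) • e x`,
  -- cancelling `χ (e x)` gives evaluation at `x`.
  have hsum : ∑ x, e x = 1 := by
    refine Subtype.ext ?_
    rw [AddSubmonoidClass.coe_finsetSum]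
    exact Finset.univ_sum_single _
  have hex : ∃ x, χ (e x) ≠ 0 := by
    by_contra! h
    have := congrArg χ hsum
    rw [map_sum, map_one, Finset.sum_eq_zero fun x _ => h x] at this
    exact zero_ne_one this
  obtain ⟨x, hx⟩ := hex
  refine ⟨x, fun f => ?_⟩
  have hf : f * e x = f.1 x • e x := by
    refine Subtype.ext (funext fun y => ?_)
    rcases eq_or_ne y x with rfl | hy
    · simp [e]
    · simp [e, hy]
  have := congrArg χ hf
  rw [map_mul, map_smul, smul_eq_mul] at this
  exact mul_right_cancel₀ hx this

/-- Composing point evaluations with `φ` and `φ⁻¹` gives characters, hence point maps in both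
directions; testing on indicators shows that they are mutually inverse. -/
theorem exists_equiv_of_algEquiv [Finite X₁] [Finite X₂] (h₁ : ∀ f, f ∈ MultAlg H₁)
    (h₂ : ∀ f, f ∈ MultAlg H₂) (φ : MultAlg H₁ ≃ₐ[ℂ] MultAlg H₂) :
    ∃ G : X₁ ≃ X₂, (∀ f x, (φ f).1 (G x) = f.1 x) ∧ ∀ f x, (φ.symm f).1 x = f.1 (G x) := by
  classical
  have a1 : ∀ y : X₂, ∃ x : X₁, ∀ f, (φ f).1 y = f.1 x := fun y =>
    exists_eval_of_algHom h₁ (((Pi.evalAlgHom ℂ (fun _ => ℂ) y).comp (MultAlg H₂).val).comp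
      φ.toAlgHom)
  have a2 : ∀ x : X₁, ∃ y : X₂, ∀ f, (φ.symm f).1 x = f.1 y := fun x =>
    exists_eval_of_algHom h₂ (((Pi.evalAlgHom ℂ (fun _ => ℂ) x).comp (MultAlg H₁).val).comp
      φ.symm.toAlgHom)
  choose G hG using a1
  choose F hF using a2
  have e1 : ∀ x, G (F x) = x := fun x => by
    have h := hF x (φ ⟨Pi.single x 1, h₁ _⟩)
    rw [AlgEquiv.symm_apply_apply, hG] at h
    by_contra hne
    simp [hne] at h
  have e2 : ∀ y, F (G y) = y := fun y => by
    have h := hG y (φ.symm ⟨Pi.single y 1, h₂ _⟩)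
    rw [AlgEquiv.apply_symm_apply, hF] at h
    by_contra hne
    simp [hne] at h
  exact ⟨⟨F, G, e1, e2⟩, fun f x => by rw [hG]; exact congrArg f.1 (e1 x), fun f x => hF x f⟩

end MultiplierAlgebras

/-! ### The spaces `H_X` and positivity derived from completely bounded maps. -/

section Quotients

variable {ι : Type*}

theorem kerAt_mem_daQuotient {X : Set (UnitBall ι)} {x : UnitBall ι} (hx : x ∈ X) :
    kerAt (DruryArveson ι) x ∈ daQuotient X :=
  Submodule.le_topologicalClosure _ (Submodule.subset_span ⟨x, hx, rfl⟩)

theorem daQuotient_apply {X : Set (UnitBall ι)} (h : daQuotient X) (x : X) :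
    h x = (h : DruryArveson ι) x := rfl

theorem coe_kerAt_daQuotient {X : Set (UnitBall ι)} (x : X) :
    (kerAt (daQuotient X) x : DruryArveson ι) = kerAt (DruryArveson ι) (x : UnitBall ι) := by
  have : kerAt (daQuotient X) x = ⟨kerAt (DruryArveson ι) x, kerAt_mem_daQuotient x.2⟩ := by
    refine ext_inner_right ℂ fun h => ?_
    rw [inner_kerAt, Submodule.coe_inner, inner_kerAt, daQuotient_apply]
  rw [this]

theorem inner_kerAt_daQuotient {X : Set (UnitBall ι)} (x y : X) :
    inner ℂ (kerAt (daQuotient X) x) (kerAt (daQuotient X) y) =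
      (1 - inner ℂ (y : HilbertCd ι) (x : HilbertCd ι) : ℂ)⁻¹ := by
  rw [Submodule.coe_inner, coe_kerAt_daQuotient, coe_kerAt_daQuotient, inner_kerAt_kerAt]

/-- The restriction of a function in the Drury-Arveson space to `X`. -/
def daRestrict (X : Set (UnitBall ι)) : DruryArveson ι →L[ℂ] daQuotient X :=
  (daQuotient X).orthogonalProjectionOnto

theorem daRestrict_apply {X : Set (UnitBall ι)} (h : DruryArveson ι) (x : X) :
    daRestrict X h x = h x := by
  rw [← inner_kerAt, ← inner_kerAt (x : UnitBall ι), ← coe_kerAt_daQuotient]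
  exact Submodule.inner_orthogonalProjectionOnto_eq_of_mem_left _ _

theorem norm_daRestrict_le {X : Set (UnitBall ι)} (h : DruryArveson ι) :
    ‖daRestrict X h‖ ≤ ‖h‖ :=
  Submodule.norm_orthogonalProjectionOnto_apply_le _ _

theorem exists_separation (S : Finset (UnitBall ι)) : ∃ δ : ℝ, 0 < δ ∧ δ ≤ 2 ∧
    ∀ x ∈ S, ∀ y ∈ S, y ≠ x → δ ≤ ‖(x : HilbertCd ι) - y‖ := by
  have h1 : ∀ᶠ δ : ℝ in 𝓝[>] 0, ∀ x ∈ S, ∀ y ∈ S, y ≠ x → δ ≤ ‖(x : HilbertCd ι) - y‖ := by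
    rw [eventually_all_finset]
    intro x _
    rw [eventually_all_finset]
    intro y _
    rcases eq_or_ne y x with rfl | hyx
    · simp
    have : 0 < ‖(x : HilbertCd ι) - y‖ :=
      norm_pos_iff.mpr (sub_ne_zero.mpr fun h => hyx (Subtype.ext h.symm))
    filter_upwards [nhdsWithin_le_nhds (Iic_mem_nhds this)] with δ hδ _ using hδ
  obtain ⟨δ, h, h0, h2⟩ := (h1.and ((eventually_mem_nhdsWithin (a := (0 : ℝ))).and
    (nhdsWithin_le_nhds (Iic_mem_nhds (two_pos (α := ℝ)))))).exists
  exact ⟨δ, h0, h2, h⟩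

/-- The interpolating multiplier is applied to the constant function `1`, the kernel function at the
origin, and the result is projected to `H_X`. -/
theorem exists_interpolating_daQuotient {X : Set (UnitBall ι)} (hX : X.Finite) (x : X) :
    ∃ e : daQuotient X, e x = 1 ∧ ∀ y, y ≠ x → e y = 0 := by
  obtain ⟨δ, hδ, hδ2, hS⟩ := exists_separation hX.toFinset
  obtain ⟨p, ⟨M, hM, -⟩, hp1, hp0⟩ := (preservesKernel_id (ι := ι)).exists_interpolating
    hX.toFinset x hδ hδ2 (hS x (by simp))
  have h0 : ∀ z, kerAt (DruryArveson ι) (⟨0, by simp⟩ : UnitBall ι) z = 1 := fun z => by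
    rw [kerAt_druryArveson_apply]; simp
  refine ⟨daRestrict X (M (kerAt (DruryArveson ι) ⟨0, by simp⟩)), ?_, fun y hy => ?_⟩
  · rw [daRestrict_apply, hM, h0, hp1 x rfl, one_mul]
  · rw [daRestrict_apply, hM, h0, hp0 y (by simp) (fun h => hy (Subtype.ext h)) y rfl, zero_mul]

theorem mem_multAlg_daQuotient {X : Set (UnitBall ι)} (hX : X.Finite) (f : X → ℂ) :
    f ∈ MultAlg (daQuotient X) :=
  have := hX.to_subtype
  mem_multAlg_of_finite (exists_interpolating_daQuotient hX) f

theorem nontrivial_daQuotient {X : Set (UnitBall ι)} (hX : X.Nonempty) :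
    Nontrivial (daQuotient X) := by
  obtain ⟨x, hx⟩ := hX
  refine ⟨kerAt (daQuotient X) ⟨x, hx⟩, 0, fun h => ?_⟩
  have h1 := inner_kerAt_daQuotient (⟨x, hx⟩ : X) ⟨x, hx⟩
  rw [h, inner_zero_right] at h1
  exact inv_ne_zero (UnitBall.one_sub_inner_ne_zero x x) h1.symm

theorem norm_sq_sum_elemTensor {H : Type*} [NormedAddCommGroup H] [InnerProductSpace ℂ H] {m : ℕ}
    {v : Fin m → HilbertCd ι} (hv : Orthonormal ℂ v) (h : Fin m → H) :
    ‖∑ j, elemTensor (star (v j)) (h j)‖ ^ 2 = ∑ j, ‖h j‖ ^ 2 := by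
  classical
  have : (inner ℂ (∑ j, elemTensor (star (v j)) (h j))
      (∑ j, elemTensor (star (v j)) (h j)) : ℂ) = ∑ j, inner ℂ (h j) (h j) := by
    rw [sum_inner]
    refine Finset.sum_congr rfl fun i _ => ?_
    rw [inner_sum, Finset.sum_eq_single i]
    · rw [inner_elemTensor, inner_star_star, inner_self_eq_norm_sq_to_K, hv.1]
      simp
    · intro j _ hj
      rw [inner_elemTensor, inner_star_star, hv.2 hj, zero_mul]
    · simp
  simp only [inner_self_eq_norm_sq_to_K, Complex.coe_algebraMap] at this
  exact_mod_cast this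

/-- The column `(h_j)` embeds isometrically as `∑ star v_j ⊗ h_j`; the row then acts as the row
contraction of `Φ` followed by restriction to `X`. -/
theorem PreservesKernel.multMatrixNorm_firstRow_le {Φ : UnitBall ι → UnitBall ι}
    (hΦ : PreservesKernel Φ) {X : Set (UnitBall ι)} {m : ℕ} {v : Fin m → HilbertCd ι}
    (hv : Orthonormal ℂ v) (f : Fin m → MultAlg (daQuotient X))
    (hf : ∀ j x, (f j).1 x = inner ℂ (v j) (Φ x : HilbertCd ι)) :
    multMatrixNorm (firstRow f) ≤ 1 := by
  obtain ⟨M, hM, hM1⟩ := hΦ.exists_isRowMultOp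
  rw [multMatrixNorm, firstRow_map _ _ multOp_zero, ← ofReal_norm, ENNReal.ofReal_le_one]
  refine ContinuousLinearMap.opNorm_le_bound _ zero_le_one fun h => ?_
  rw [one_mul, norm_opMatrix_firstRow_apply]
  let g := ∑ j, elemTensor (star (v j)) (h j : DruryArveson ι)
  have e : ∑ j, multOp (f j) (h j) = daRestrict X (M g) := by
    refine RKHS.ext fun x => ?_
    rw [daRestrict_apply, ← RKHS.coeCLM_apply (𝕜 := ℂ), map_sum, Finset.sum_apply, map_sum,
      ← RKHS.coeCLM_apply (𝕜 := ℂ), map_sum, Finset.sum_apply]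
    refine Finset.sum_congr rfl fun j _ => ?_
    rw [RKHS.coeCLM_apply, multOp_apply, hf, RKHS.coeCLM_apply]
    refine (HasSum.of_forall_eq ((lp.hasSum_inner (𝕜 := ℂ) (v j) (Φ x : HilbertCd ι)).mul_right
      ((h j : DruryArveson ι) x)) fun i => ?_).unique
      (hM (elemTensor (star (v j)) (h j : DruryArveson ι)) x)
    simp [elemTensor_apply]
    ring
  have hg : ‖g‖ = ‖h‖ := by
    refine (sq_eq_sq₀ (norm_nonneg _) (norm_nonneg _)).mp ?_
    rw [norm_sq_sum_elemTensor hv, PiLp.norm_sq_eq_of_L2]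
    rfl
  rw [e, ← hg]
  refine (norm_daRestrict_le _).trans ((M.le_opNorm g).trans ?_)
  exact mul_le_of_le_one_left (norm_nonneg _) hM1

theorem multMatrixNorm_map_le {X₁ X₂ H₁ H₂ : Type*} [NormedAddCommGroup H₁]
    [InnerProductSpace ℂ H₁] [RKHS ℂ H₁ X₁ ℂ] [NormedAddCommGroup H₂] [InnerProductSpace ℂ H₂]
    [RKHS ℂ H₂ X₂ ℂ] {φ : MultAlg H₁ →ₗ[ℂ] MultAlg H₂} {m : ℕ}
    {A : Matrix (Fin m) (Fin m) (MultAlg H₁)} (hA : multMatrixNorm A ≤ 1) :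
    multMatrixNorm (A.map φ) ≤ cbNorm φ :=
  le_iSup_of_le m (le_iSup_of_le A (le_iSup_of_le hA le_rfl))

/-- The components of `Φ` form a row contraction over `H_X`, so their images under `φ` form a row of
norm at most `c` over `H_Y`. Applying the adjoint of that row to combinations of kernel functions
turns this bound into positivity. -/
theorem cbNorm_row_nonneg {X Y : Set (UnitBall ι)} (hX : X.Finite)
    {φ : MultAlg (daQuotient X) →ₗ[ℂ] MultAlg (daQuotient Y)} {G : Y → X}
    (hG : ∀ f y, (φ f).1 y = f.1 (G y)) {c : ℝ} (hc : 0 ≤ c) (hφ : cbNorm φ ≤ ENNReal.ofReal c)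
    {Φ : UnitBall ι → UnitBall ι} (hΦ : PreservesKernel Φ) {α : Type*} [Fintype α] (p : α → Y)
    (v : α → ℂ) :
    0 ≤ (∑ i, ∑ l, conj (v i) * v l *
      ((c ^ 2 - inner ℂ (Φ (G (p l)) : HilbertCd ι) (Φ (G (p i)) : HilbertCd ι)) *
        (1 - inner ℂ (p l : HilbertCd ι) (p i : HilbertCd ι))⁻¹) : ℂ).re := by
  have := hX.to_subtype
  -- An orthonormal basis of the span of the finitely many vectors `Φ x` is enough, so finite
  -- matrices suffice even in infinite dimension.
  let E := Submodule.span ℂ (Set.range fun x : X => (Φ x : HilbertCd ι))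
  have hE : FiniteDimensional ℂ E := FiniteDimensional.span_of_finite ℂ (Set.finite_range _)
  let b := stdOrthonormalBasis ℂ E
  have hb : Orthonormal ℂ (fun j => (b j : HilbertCd ι)) :=
    b.orthonormal.comp_linearIsometry E.subtypeₗᵢ
  let a : X → E := fun x => ⟨Φ x, Submodule.subset_span ⟨x, rfl⟩⟩
  let f : Fin (Module.finrank ℂ E) → MultAlg (daQuotient X) := fun j =>
    ⟨fun x => inner ℂ (b j) (a x), mem_multAlg_daQuotient hX _⟩
  have hrow := multMatrixNorm_map_le (φ := φ)
    (hΦ.multMatrixNorm_firstRow_le hb f fun j x => rfl)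
  rw [firstRow_map _ _ (map_zero φ), multMatrixNorm, firstRow_map _ _ multOp_zero] at hrow
  have hrow' := hrow.trans hφ
  rw [← ofReal_norm, ENNReal.ofReal_le_ofReal_iff hc] at hrow'
  have key := sum_norm_adjoint_sq_le _ hrow' (∑ i, v i • kerAt (daQuotient Y) (p i))
  have hadj : ∀ j, ContinuousLinearMap.adjoint (multOp (φ (f j)))
      (∑ i, v i • kerAt (daQuotient Y) (p i)) =
      ∑ i, (v i * conj (inner ℂ (b j) (a (G (p i))))) • kerAt (daQuotient Y) (p i) := fun j => by
    rw [map_sum]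
    refine Finset.sum_congr rfl fun i _ => ?_
    rw [map_smul, adjoint_multOp_kerAt, hG, smul_smul]
  simp only [hadj] at key
  have hform : ∀ w : α → ℂ, ((‖∑ i, w i • kerAt (daQuotient Y) (p i)‖ ^ 2 : ℝ) : ℂ) =
      ∑ i, ∑ l, conj (w i) * w l *
        (1 - inner ℂ (p l : HilbertCd ι) (p i : HilbertCd ι))⁻¹ := fun w => by
    have h1 := inner_self_eq_norm_sq_to_K (𝕜 := ℂ) (∑ i, w i • kerAt (daQuotient Y) (p i))
    simp only [Complex.coe_algebraMap] at h1
    push_cast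
    rw [← h1, sum_inner]
    refine Finset.sum_congr rfl fun i _ => ?_
    rw [inner_sum]
    refine Finset.sum_congr rfl fun l _ => ?_
    rw [inner_smul_left, inner_smul_right, inner_kerAt_daQuotient]
    ring
  suffices h : (∑ i, ∑ l, conj (v i) * v l *
      ((c ^ 2 - inner ℂ (Φ (G (p l)) : HilbertCd ι) (Φ (G (p i)) : HilbertCd ι)) *
        (1 - inner ℂ (p l : HilbertCd ι) (p i : HilbertCd ι))⁻¹) : ℂ) =
      ((c ^ 2 * ‖∑ i, v i • kerAt (daQuotient Y) (p i)‖ ^ 2 -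
      ∑ j, ‖∑ i, (v i * conj (inner ℂ (b j) (a (G (p i))))) •
        kerAt (daQuotient Y) (p i)‖ ^ 2 : ℝ) : ℂ) by
    rw [h, Complex.ofReal_re]
    linarith
  rw [Complex.ofReal_sub, Complex.ofReal_mul, Complex.ofReal_sum, hform]
  simp only [hform]
  rw [Finset.sum_comm (s := (Finset.univ : Finset (Fin (Module.finrank ℂ E)))), Finset.mul_sum,
    ← Finset.sum_sub_distrib]
  refine Finset.sum_congr rfl fun i _ => ?_
  rw [Finset.sum_comm (s := (Finset.univ : Finset (Fin (Module.finrank ℂ E)))), Finset.mul_sum,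
    ← Finset.sum_sub_distrib]
  refine Finset.sum_congr rfl fun l _ => ?_
  have hpars : (inner ℂ (Φ (G (p l)) : HilbertCd ι) (Φ (G (p i)) : HilbertCd ι) : ℂ) =
      ∑ j, conj (inner ℂ (b j) (a (G (p l)))) * inner ℂ (b j) (a (G (p i))) := by
    refine (b.sum_inner_mul_inner (a (G (p l))) (a (G (p i)))).symm.trans
      (Finset.sum_congr rfl fun j _ => ?_)
    exact congrArg (· * _) (inner_conj_symm _ _).symm
  rw [hpars, sub_mul, mul_sub, Finset.sum_mul, Finset.mul_sum]
  congr 1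
  · push_cast
    ring
  · refine Finset.sum_congr rfl fun j _ => ?_
    rw [map_mul, Complex.conj_conj]
    ring

theorem cbNorm_row_nonneg_of_preservesKernel {X Y : Set (UnitBall ι)} (hX : X.Finite)
    {φ : MultAlg (daQuotient X) →ₗ[ℂ] MultAlg (daQuotient Y)} {G : Y → X}
    (hG : ∀ f y, (φ f).1 y = f.1 (G y)) {c : ℝ} (hc : 0 ≤ c) (hφ : cbNorm φ ≤ ENNReal.ofReal c)
    {Φ Ψ : UnitBall ι → UnitBall ι} (hΦ : PreservesKernel Φ) (hΨ : PreservesKernel Ψ)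
    {α : Type*} [Fintype α] (p : α → Y) (u : α → ℂ) :
    0 ≤ (∑ i, ∑ l, conj (u i) * u l *
      ((c ^ 2 - inner ℂ (Φ (G (p l)) : HilbertCd ι) (Φ (G (p i)) : HilbertCd ι)) *
        (1 - inner ℂ (Ψ (p l) : HilbertCd ι) (Ψ (p i) : HilbertCd ι))⁻¹) : ℂ).re := by
  obtain ⟨g, hg0, hg⟩ := hΨ.exists_ne_zero
  -- Dividing the coefficients by `conj (g (p i))` absorbs the rescaling of the kernel by `Ψ`.
  have h := cbNorm_row_nonneg hX hG hc hφ hΦ p (fun i => u i / conj (g (p i)))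
  refine h.trans_eq (congrArg Complex.re
    (Finset.sum_congr rfl fun i _ => Finset.sum_congr rfl fun l _ => ?_))
  rw [hg]
  have h1 := (map_ne_zero (starRingEnd ℂ)).mpr (hg0 (p l))
  have h2 := hg0 (p i)
  have h3 := UnitBall.one_sub_inner_ne_zero (p l : UnitBall ι) (p i)
  rw [map_div₀, Complex.conj_conj]
  field_simp

end Quotients

/-! ### From positivity to Gram matrices, and from Gram matrices to unitaries. -/

section GramMatrices

variable {E : Type*} [NormedAddCommGroup E] [InnerProductSpace ℂ E]

/-- The kernel equals `B + c²`, where `B` has numerator `c² ⟨b_l, b_i⟩ - ⟨a_l, a_i⟩` and vanishes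
whenever an index is the base point `0`. Hence `B` is positive on the other two points, and its
off-diagonal entry is at most the mean of its diagonal entries. -/
theorem norm_sub_inner_le_of_form_nonneg {a b : Fin 3 → E} (ha0 : a 0 = 0) (hb0 : b 0 = 0)
    (hb : ∀ i, ‖b i‖ < 1) {c : ℝ}
    (h : ∀ u : Fin 3 → ℂ, 0 ≤ (∑ i, ∑ l, conj (u i) * u l *
      ((c ^ 2 - inner ℂ (a l) (a i)) * (1 - inner ℂ (b l) (b i))⁻¹) : ℂ).re) :
    0 ≤ (c ^ 2 * ‖b 1‖ ^ 2 - ‖a 1‖ ^ 2) / (1 - ‖b 1‖ ^ 2) ∧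
    ‖(c ^ 2 * inner ℂ (b 2) (b 1) - inner ℂ (a 2) (a 1) : ℂ)‖ ≤
      (c ^ 2 * ‖b 1‖ ^ 2 - ‖a 1‖ ^ 2) / (1 - ‖b 1‖ ^ 2) +
      (c ^ 2 * ‖b 2‖ ^ 2 - ‖a 2‖ ^ 2) / (1 - ‖b 2‖ ^ 2) := by
  let B : Fin 3 → Fin 3 → ℂ := fun i l =>
    (c ^ 2 * inner ℂ (b l) (b i) - inner ℂ (a l) (a i)) * (1 - inner ℂ (b l) (b i))⁻¹
  have hne : ∀ i l, (1 - inner ℂ (b l) (b i) : ℂ) ≠ 0 := fun i l h => by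
    have h1 : (inner ℂ (b l) (b i) : ℂ) = 1 := (sub_eq_zero.mp h).symm
    have h2 := norm_inner_le_norm (𝕜 := ℂ) (b l) (b i)
    rw [h1, norm_one] at h2
    nlinarith [norm_nonneg (b l), norm_nonneg (b i), hb l, hb i]
  have hB : ∀ i l, (c ^ 2 - inner ℂ (a l) (a i)) * (1 - inner ℂ (b l) (b i))⁻¹ =
      B i l + (c : ℂ) ^ 2 := fun i l => by
    have := hne i l
    simp only [B]
    field_simp
    ring
  have hB0 : ∀ i, B i 0 = 0 ∧ B 0 i = 0 := fun i => by simp [B, ha0, hb0]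
  have hst : ∀ s t : ℂ, 0 ≤ (conj s * s * B 1 1 + conj s * t * B 1 2 + conj t * s * B 2 1 +
      conj t * t * B 2 2).re := fun s t => by
    -- Coefficients of sum zero annihilate the constant `c²`, and the base point contributes nothing
    -- to `B`.
    refine (h ![-(s + t), s, t]).trans_eq (congrArg Complex.re ?_)
    simp only [hB, Fin.sum_univ_three, hB0, Matrix.cons_val_zero, Matrix.cons_val_one,
      Matrix.cons_val, map_neg, map_add]
    ring
  have hdiag : ∀ i, B i i = (((c ^ 2 * ‖b i‖ ^ 2 - ‖a i‖ ^ 2) / (1 - ‖b i‖ ^ 2) : ℝ) : ℂ) :=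
    fun i => by
      simp only [B, inner_self_eq_norm_sq_to_K, Complex.coe_algebraMap]
      push_cast
      rw [div_eq_mul_inv]
  have hconj : B 2 1 = conj (B 1 2) := by
    simp only [B, map_mul, map_sub, map_inv₀, map_pow, map_one, inner_conj_symm,
      Complex.conj_ofReal]
  constructor
  · have := hst 1 0
    simpa only [map_one, map_zero, one_mul, zero_mul, mul_zero, add_zero, hdiag,
      Complex.ofReal_re] using this
  have h12 : 2 * ‖B 1 2‖ ≤ (c ^ 2 * ‖b 1‖ ^ 2 - ‖a 1‖ ^ 2) / (1 - ‖b 1‖ ^ 2) +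
      (c ^ 2 * ‖b 2‖ ^ 2 - ‖a 2‖ ^ 2) / (1 - ‖b 2‖ ^ 2) := by
    -- A unimodular `t` turns the off-diagonal term into `-‖B 1 2‖`.
    obtain ⟨t, ht, htB⟩ : ∃ t : ℂ, conj t * t = 1 ∧ t * B 1 2 = -(‖B 1 2‖ : ℂ) := by
      rcases eq_or_ne (B 1 2) 0 with h0 | h0
      · exact ⟨1, by simp, by simp [h0]⟩
      · have hn : (‖B 1 2‖ : ℂ) ≠ 0 := by exact_mod_cast (norm_pos_iff.mpr h0).ne'
        have hm := Complex.conj_mul' (B 1 2)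
        refine ⟨-(conj (B 1 2) / ‖B 1 2‖), ?_, ?_⟩
        · simp only [map_neg, map_div₀, Complex.conj_conj, Complex.conj_ofReal]
          field_simp
          linear_combination hm
        · field_simp
          linear_combination -hm
    have h1 := hst 1 t
    have e : conj t * 1 * B 2 1 = conj (t * B 1 2) := by
      rw [hconj, mul_one]
      exact (map_mul _ _ _).symm
    rw [e, ht, map_one, one_mul, one_mul, one_mul, one_mul, htB, hdiag, hdiag, map_neg,
      Complex.conj_ofReal] at h1
    simp only [Complex.add_re, Complex.neg_re, Complex.ofReal_re] at h1
    linarith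
  have e : (c ^ 2 * inner ℂ (b 2) (b 1) - inner ℂ (a 2) (a 1) : ℂ) =
      B 1 2 * (1 - inner ℂ (b 2) (b 1)) := by
    simp only [B]
    rw [inv_mul_cancel_right₀ (hne 1 2)]
  -- Clearing the denominator costs a factor `2`, which cancels the one in `h12`.
  have hle : ‖(1 - inner ℂ (b 2) (b 1) : ℂ)‖ ≤ 2 := by
    have h1 := norm_sub_le (1 : ℂ) (inner ℂ (b 2) (b 1))
    have h2 := norm_inner_le_norm (𝕜 := ℂ) (b 2) (b 1)
    rw [norm_one] at h1
    nlinarith [norm_nonneg (b 2), norm_nonneg (b 1), hb 2, hb 1]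
  rw [e, norm_mul]
  nlinarith [norm_nonneg (B 1 2)]

/-- The complex Householder reflection taking `u` to `v`. -/
theorem exists_unitary_of_norm_eq [CompleteSpace E] {u v : E} (huv : ‖u‖ = ‖v‖) :
    ∃ U : E ≃ₗᵢ[ℂ] E, U u = v ∧ ∀ z, inner ℂ u z = 0 → inner ℂ v z = 0 → U z = z := by
  rcases eq_or_ne u v with rfl | hne
  · exact ⟨LinearIsometryEquiv.refl ℂ E, rfl, fun z _ _ => rfl⟩
  let w := u - v
  -- The map is `z ↦ z - (⟨w, z⟩ / α) w`. Dividing by `α` instead of `‖w‖² / 2` sends `u` to `v`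
  -- even if `⟨u, v⟩` is not real; isometry amounts to `α + conj α = ‖w‖²`.
  let α : ℂ := inner ℂ w u
  let β : ℂ := inner ℂ w v
  have hnorm : (inner ℂ u u : ℂ) = inner ℂ v v := by
    rw [inner_self_eq_norm_sq_to_K, inner_self_eq_norm_sq_to_K, huv]
  have hw : w ≠ 0 := sub_ne_zero.mpr hne
  have hαβ : α - β = inner ℂ w w := by rw [← inner_sub_right]
  have hβ : β = -conj α := by
    simp only [α, β, w, inner_sub_left, map_sub, inner_conj_symm, hnorm]
    ring
  have hsum : α + conj α = inner ℂ w w := by rw [← hαβ, hβ]; ring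
  have hα : α ≠ 0 := fun h => by
    rw [h, map_zero, add_zero] at hsum
    exact inner_self_ne_zero.mpr hw hsum.symm
  have hα' : conj α ≠ 0 := (map_ne_zero (starRingEnd ℂ)).mpr hα
  have hnp : ∀ z, ‖z - (inner ℂ w z / α) • w‖ = ‖z‖ := fun z => by
    refine (sq_eq_sq₀ (norm_nonneg _) (norm_nonneg _)).mp ?_
    have : (inner ℂ (z - (inner ℂ w z / α) • w) (z - (inner ℂ w z / α) • w) : ℂ) =
        inner ℂ z z := by
      have hzw : (inner ℂ z w : ℂ) = conj (inner ℂ w z) := (inner_conj_symm _ _).symm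
      simp only [inner_sub_left, inner_sub_right, inner_smul_left, inner_smul_right, hzw,
        map_div₀, ← hsum]
      field_simp
      ring
    rw [inner_self_eq_norm_sq_to_K, inner_self_eq_norm_sq_to_K] at this
    simp only [Complex.coe_algebraMap] at this
    exact_mod_cast this
  let T : E →ₗᵢ[ℂ] E :=
    ⟨LinearMap.id - (LinearMap.smulRight (α⁻¹ • (innerSL ℂ w : E →ₗ[ℂ] ℂ)) w), fun z => by
      simpa [div_eq_inv_mul] using hnp z⟩
  have hT : ∀ z, T z = z - (inner ℂ w z / α) • w := fun z => by
    simp [T, div_eq_inv_mul]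
  have hsurj : Function.Surjective T := fun y => by
    refine ⟨y - (inner ℂ w y / conj α) • w, ?_⟩
    rw [hT, inner_sub_right, inner_smul_right, ← hsum, sub_sub, ← add_smul]
    convert sub_zero y using 2
    convert zero_smul ℂ w using 2
    field_simp
    ring
  refine ⟨LinearIsometryEquiv.ofSurjective T hsurj, ?_, fun z hu hv => ?_⟩
  · rw [LinearIsometryEquiv.coe_ofSurjective, hT, div_self hα, one_smul, sub_sub_cancel]
  · rw [LinearIsometryEquiv.coe_ofSurjective, hT, inner_sub_left, hu, hv]
    simp

/-- Gram–Schmidt by induction. Once the points of `s` are aligned, the Gram data determine the limit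
of the projection of the next point to `W = span x(s)`, and of the norm of its component orthogonal
to `W`. A reflection that fixes `W` pointwise turns this component in the right direction. -/
theorem exists_unitary_tendsto_of_gram [CompleteSpace E] {K β : Type*} {l : Filter K}
    (x : β → E) (y : K → β → E)
    (h : ∀ i j, Tendsto (fun k => (inner ℂ (y k i) (y k j) : ℂ)) l (𝓝 (inner ℂ (x i) (x j))))
    (s : Finset β) :
    ∃ U : K → (E ≃ₗᵢ[ℂ] E), ∀ i ∈ s, Tendsto (fun k => U k (y k i)) l (𝓝 (x i)) := by
  classical
  induction s using Finset.induction_on with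
  | empty => exact ⟨fun _ => LinearIsometryEquiv.refl ℂ E, by simp⟩
  | insert m s hm ih =>
    obtain ⟨U, hU⟩ := ih
    let W := Submodule.span ℂ (x '' s)
    have hWfin : FiniteDimensional ℂ W :=
      FiniteDimensional.span_of_finite ℂ (s.finite_toSet.image x)
    let b := stdOrthonormalBasis ℂ W
    let z : K → E := fun k => U k (y k m)
    have hznorm : Tendsto (fun k => ‖z k‖) l (𝓝 ‖x m‖) := by
      have h1 := (h m m).norm.sqrt
      simp only [inner_self_eq_norm_sq_to_K, Complex.coe_algebraMap, norm_pow, Complex.norm_real,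
        norm_norm, Real.sqrt_sq (norm_nonneg _)] at h1
      simpa [z] using h1
    have hinner : ∀ w ∈ W, Tendsto (fun k => (inner ℂ w (z k) : ℂ)) l (𝓝 (inner ℂ w (x m))) := by
      intro w hw
      induction hw using Submodule.span_induction with
      | mem w hw =>
        obtain ⟨i, hi, rfl⟩ := hw
        have h1 : Tendsto (fun k => (inner ℂ (x i - U k (y k i)) (z k) : ℂ)) l (𝓝 0) := by
          refine squeeze_zero_norm (fun k => norm_inner_le_norm _ _) ?_
          have := ((tendsto_const_nhds (x := x i)).sub (hU i hi)).norm.mul hznorm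
          simpa using this
        have h2 := h1.add (h i m)
        simp only [zero_add] at h2
        refine h2.congr fun k => ?_
        rw [inner_sub_left]
        simp [z]
      | zero => simpa only [inner_zero_left] using tendsto_const_nhds
      | add w w' _ _ hw hw' => simpa only [inner_add_left] using hw.add hw'
      | smul c w _ hw => simpa only [inner_smul_left] using hw.const_mul (conj c)
    have hproj : Tendsto (fun k => W.starProjection (z k)) l (𝓝 (W.starProjection (x m))) := by
      have e : ∀ v : E, W.starProjection v = ∑ j, (inner ℂ (b j : E) v : ℂ) • (b j : E) := fun v => by
        rw [b.starProjection_eq_sum_rankOne]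
        simp
      simp only [e]
      exact tendsto_finsetSum _ fun j _ => (hinner _ (b j).2).smul_const _
    let u : K → E := fun k => z k - W.starProjection (z k)
    let v : E := x m - W.starProjection (x m)
    have hun : Tendsto (fun k => ‖u k‖) l (𝓝 ‖v‖) := by
      have e : ∀ v : E, ‖v - W.starProjection v‖ =
          Real.sqrt (‖v‖ ^ 2 - ‖W.starProjection v‖ ^ 2) := fun v => by
        have := W.norm_sq_eq_add_norm_sq_starProjection v
        rw [Submodule.starProjection_orthogonal_val] at this
        rw [this, add_sub_cancel_left, Real.sqrt_sq (norm_nonneg _)]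
      simp only [u, v, e]
      exact ((hznorm.pow 2).sub (hproj.norm.pow 2)).sqrt
    have huW : ∀ v : E, ∀ w ∈ W, (inner ℂ (v - W.starProjection v) w : ℂ) = 0 := fun v w hw =>
      Submodule.starProjection_inner_eq_zero v w hw
    have hV : ∃ V : K → (E ≃ₗᵢ[ℂ] E), (∀ k, ∀ w ∈ W, V k w = w) ∧
        Tendsto (fun k => V k (u k)) l (𝓝 v) := by
      -- If the limiting component vanishes there is no direction to aim at, and none is needed.
      rcases eq_or_ne v 0 with hv | hv
      · refine ⟨fun _ => LinearIsometryEquiv.refl ℂ E, fun _ _ _ => rfl, ?_⟩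
        rw [hv, tendsto_zero_iff_norm_tendsto_zero]
        simpa [hv] using hun
      · have hv' : ‖v‖ ≠ 0 := norm_ne_zero_iff.mpr hv
        have hex : ∀ k, ∃ V : E ≃ₗᵢ[ℂ] E, (∀ w ∈ W, V w = w) ∧
            V (u k) = ((‖u k‖ / ‖v‖ : ℝ) : ℂ) • v := fun k => by
          obtain ⟨V, hV1, hV2⟩ := exists_unitary_of_norm_eq (u := u k)
            (v := ((‖u k‖ / ‖v‖ : ℝ) : ℂ) • v) (by
              rw [norm_smul, Complex.norm_real, Real.norm_of_nonneg (by positivity),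
                div_mul_cancel₀ _ hv'])
          refine ⟨V, fun w hw => hV2 w (huW _ w hw) ?_, hV1⟩
          rw [inner_smul_left, huW _ w hw, mul_zero]
        choose V hV1 hV2 using hex
        refine ⟨V, hV1, ?_⟩
        simp only [hV2]
        have h1 : Tendsto (fun k => ((‖u k‖ / ‖v‖ : ℝ) : ℂ)) l (𝓝 ((‖v‖ / ‖v‖ : ℝ) : ℂ)) :=
          (Complex.continuous_ofReal.tendsto _).comp (hun.div_const _)
        rw [div_self hv'] at h1
        simpa using h1.smul_const v
    obtain ⟨V, hVW, hVu⟩ := hV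
    refine ⟨fun k => (U k).trans (V k), fun i hi => ?_⟩
    rcases Finset.mem_insert.mp hi with rfl | hi
    · have h1 := hVu.add hproj
      have h2 : v + W.starProjection (x i) = x i := sub_add_cancel _ _
      rw [h2] at h1
      refine h1.congr fun k => ?_
      have h3 := hVW k _ (W.starProjection_apply_mem (z k))
      calc V k (u k) + W.starProjection (z k)
          = V k (u k) + V k (W.starProjection (z k)) := by rw [h3]
        _ = V k (z k) := by rw [← map_add]; exact congrArg _ (sub_add_cancel _ _)
        _ = _ := rfl
    · have hxi : x i ∈ W := Submodule.subset_span ⟨i, hi, rfl⟩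
      rw [tendsto_iff_norm_sub_tendsto_zero]
      refine (tendsto_iff_norm_sub_tendsto_zero.mp (hU i hi)).congr fun k => ?_
      rw [LinearIsometryEquiv.trans_apply, ← (V k).norm_map (U k (y k i) - x i), map_sub,
        hVW k _ hxi]

end GramMatrices

/-! ### Algebra isomorphisms of small distortion force small distance. -/

section AlgebraToDistance

variable {ι : Type*}

theorem rhoS_nonneg (X Y : Set (UnitBall ι)) : 0 ≤ rhoS X Y :=
  Real.iInf_nonneg fun _ => Real.iSup_nonneg fun _ => rhoPh_nonneg _ _

theorem rhoSInv_nonneg (X Y : Set (UnitBall ι)) : 0 ≤ rhoSInv X Y :=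
  Real.iInf_nonneg fun _ => rhoS_nonneg _ _

theorem rhoSInv_le {X Y : Set (UnitBall ι)} {Φ : UnitBall ι ≃ UnitBall ι}
    (hΦ : IsBiholomorphic Φ) (τ : X ≃ Y) {r : ℝ} (hr : 0 ≤ r)
    (h : ∀ x : X, rhoPh (x : UnitBall ι) (Φ (τ x)) ≤ r) : rhoSInv X Y ≤ r := by
  refine (ciInf_le ⟨0, ?_⟩ (⟨Φ, hΦ⟩ : {Φ : UnitBall ι ≃ UnitBall ι // IsBiholomorphic Φ})).trans ?_
  · rintro _ ⟨Ψ, rfl⟩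
    exact rhoS_nonneg _ _
  refine (ciInf_le ⟨0, ?_⟩ (τ.trans (Φ.image Y))).trans (Real.iSup_le h hr)
  rintro _ ⟨σ, rfl⟩
  exact Real.iSup_nonneg fun _ => rhoPh_nonneg _ _

/-- Positivity for `φ⁻¹` bounds the Gram difference by terms `(c² ‖a‖² - ‖b‖²) / (1 - ‖a‖²)`, and
positivity for `φ` gives `‖a‖² ≤ c² ‖b‖²`. Together they eliminate `b` from the bound, so nothing
about the position of `Y` is needed. -/
theorem gram_estimate_of_algEquiv {X Y : Set (UnitBall ι)} (hX : X.Finite) (hY : Y.Finite)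
    {φ : MultAlg (daQuotient X) ≃ₐ[ℂ] MultAlg (daQuotient Y)} {τ : X ≃ Y}
    (hτ : ∀ f x, (φ f).1 (τ x) = f.1 x) (hτ' : ∀ f x, (φ.symm f).1 x = f.1 (τ x)) {c : ℝ}
    (hc : 1 ≤ c) (hφ : cbNorm φ.toLinearMap ≤ ENNReal.ofReal c)
    (hφ' : cbNorm φ.symm.toLinearMap ≤ ENNReal.ofReal c) (x₀ x y : X) :
    ‖(c ^ 2 * inner ℂ (moebius (x₀ : UnitBall ι) y : HilbertCd ι)
        (moebius (x₀ : UnitBall ι) x : HilbertCd ι) -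
      inner ℂ (moebius (τ x₀ : UnitBall ι) (τ y) : HilbertCd ι)
        (moebius (τ x₀ : UnitBall ι) (τ x) : HilbertCd ι) : ℂ)‖ ≤
      (c ^ 2 - (c ^ 2)⁻¹) *
        (‖(moebius (x₀ : UnitBall ι) x : HilbertCd ι)‖ ^ 2 /
          (1 - ‖(moebius (x₀ : UnitBall ι) x : HilbertCd ι)‖ ^ 2) +
        ‖(moebius (x₀ : UnitBall ι) y : HilbertCd ι)‖ ^ 2 /
          (1 - ‖(moebius (x₀ : UnitBall ι) y : HilbertCd ι)‖ ^ 2)) := by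
  have hc0 : 0 ≤ c := zero_le_one.trans hc
  have hc2 : 0 < c ^ 2 := by positivity
  let a : X → HilbertCd ι := fun x => moebius (x₀ : UnitBall ι) x
  let b : X → HilbertCd ι := fun x => moebius (τ x₀ : UnitBall ι) (τ x)
  have ha0 : a x₀ = 0 := moebius_self _
  have hb0 : b x₀ = 0 := moebius_self _
  have ha : ∀ x, ‖a x‖ < 1 := fun x => mem_ball_zero_iff.mp (moebius (x₀ : UnitBall ι) x).2
  have hb : ∀ x, ‖b x‖ < 1 := fun x => mem_ball_zero_iff.mp (moebius (τ x₀ : UnitBall ι) (τ x)).2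
  have h1 := norm_sub_inner_le_of_form_nonneg (a := fun i => b (![x₀, x, y] i))
    (b := fun i => a (![x₀, x, y] i)) hb0 ha0 (fun i => ha _) (c := c)
    fun u => cbNorm_row_nonneg_of_preservesKernel hY (φ := φ.symm.toLinearMap) hτ' hc0 hφ'
      (preservesKernel_moebius (τ x₀ : UnitBall ι)) (preservesKernel_moebius (x₀ : UnitBall ι))
      ![x₀, x, y] u
  have hτ'' : ∀ f y, (φ f).1 y = f.1 (τ.symm y) := fun f y => by
    rw [← hτ, Equiv.apply_symm_apply]
  have h2 : ∀ x, 0 ≤ (c ^ 2 * ‖b x‖ ^ 2 - ‖a x‖ ^ 2) / (1 - ‖b x‖ ^ 2) := fun x => by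
    refine (norm_sub_inner_le_of_form_nonneg (a := fun i => a (![x₀, x, x] i))
      (b := fun i => b (![x₀, x, x] i)) ha0 hb0 (fun i => hb _) (c := c) fun u => ?_).1
    have := cbNorm_row_nonneg_of_preservesKernel hX (φ := φ.toLinearMap) hτ'' hc0 hφ
      (preservesKernel_moebius (x₀ : UnitBall ι)) (preservesKernel_moebius (τ x₀ : UnitBall ι))
      (fun i => τ (![x₀, x, x] i)) u
    simpa only [Equiv.symm_apply_apply] using this
  have h3 : ∀ x, (c ^ 2 * ‖a x‖ ^ 2 - ‖b x‖ ^ 2) / (1 - ‖a x‖ ^ 2) ≤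
      (c ^ 2 - (c ^ 2)⁻¹) * (‖a x‖ ^ 2 / (1 - ‖a x‖ ^ 2)) := fun x => by
    have p1 : 0 < 1 - ‖b x‖ ^ 2 := by nlinarith [norm_nonneg (b x), hb x]
    have p2 : 0 < 1 - ‖a x‖ ^ 2 := by nlinarith [norm_nonneg (a x), ha x]
    have p3 : 0 ≤ c ^ 2 * ‖b x‖ ^ 2 - ‖a x‖ ^ 2 := by
      have := h2 x
      rwa [le_div_iff₀ p1, zero_mul] at this
    have p4 : (c ^ 2)⁻¹ * ‖a x‖ ^ 2 ≤ ‖b x‖ ^ 2 := by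
      rw [inv_mul_le_iff₀ hc2]
      linarith
    rw [← mul_div_assoc]
    gcongr
    linarith
  rw [mul_add]
  exact h1.2.trans (add_le_add (h3 x) (h3 y))

theorem tendsto_rhoSInv_of_deltaAlg {X : Set (UnitBall ι)} (hX : X.Finite) (hX' : X.Nonempty)
    {Y : ℕ → Set (UnitBall ι)} (hY : ∀ k, (Y k).Finite) (hY' : ∀ k, (Y k).Nonempty)
    (h : Tendsto (fun k => deltaAlg (daQuotient X) (daQuotient (Y k))) atTop (𝓝 1)) :
    Tendsto (fun k => rhoSInv X (Y k)) atTop (𝓝 0) := by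
  obtain ⟨x₀, hx₀⟩ := hX'
  have := hX.to_subtype
  have := Fintype.ofFinite X
  have : Nontrivial (daQuotient X) := nontrivial_daQuotient ⟨x₀, hx₀⟩
  -- The infimum need not be attained; the slack `1 / (k + 1)` lets an actual isomorphism lie below
  -- `d k`.
  let d : ℕ → ℝ≥0∞ := fun k => deltaAlg (daQuotient X) (daQuotient (Y k)) + (k + 1 : ℝ≥0∞)⁻¹
  have hd : Tendsto d atTop (𝓝 1) := by
    have h1 : Tendsto (fun k : ℕ => (k + 1 : ℝ≥0∞)⁻¹) atTop (𝓝 0) := by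
      have := (tendsto_add_atTop_iff_nat 1).mpr ENNReal.tendsto_inv_nat_nhds_zero
      simpa using this
    simpa using h.add h1
  let c : ℕ → ℝ := fun k => (d k).toReal
  have hc : Tendsto c atTop (𝓝 1) := (ENNReal.tendsto_toReal ENNReal.one_ne_top).comp hd
  let a : X → UnitBall ι := fun x => moebius x₀ x
  have hex : ∀ k, ∃ b : X → UnitBall ι, d k < ∞ →
      (∃ τ : X ≃ Y k, b = fun x => moebius (τ ⟨x₀, hx₀⟩ : UnitBall ι) (τ x)) ∧
      ∀ x y, ‖(c k ^ 2 * inner ℂ (a y : HilbertCd ι) (a x : HilbertCd ι) -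
        inner ℂ (b y : HilbertCd ι) (b x : HilbertCd ι) : ℂ)‖ ≤
        (c k ^ 2 - (c k ^ 2)⁻¹) * (‖(a x : HilbertCd ι)‖ ^ 2 / (1 - ‖(a x : HilbertCd ι)‖ ^ 2) +
          ‖(a y : HilbertCd ι)‖ ^ 2 / (1 - ‖(a y : HilbertCd ι)‖ ^ 2)) := fun k => by
    by_cases hk : d k < ∞
    swap
    · exact ⟨a, fun h => absurd h hk⟩
    have : Nontrivial (daQuotient (Y k)) := nontrivial_daQuotient (hY' k)
    have := (hY k).to_subtype
    have hlt : deltaAlg (daQuotient X) (daQuotient (Y k)) < d k :=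
      ENNReal.lt_add_right ((le_self_add).trans_lt hk).ne (by simp)
    obtain ⟨φ, hφ⟩ := iInf_lt_iff.mp hlt
    obtain ⟨τ, hτ, hτ'⟩ := exists_equiv_of_algEquiv (mem_multAlg_daQuotient hX)
      (mem_multAlg_daQuotient (hY k)) φ
    have hdc : d k = ENNReal.ofReal (c k) := (ENNReal.ofReal_toReal hk.ne).symm
    have h1 : 1 ≤ cbNorm φ.toLinearMap := one_le_cbNorm φ
    have h2 : 1 ≤ cbNorm φ.symm.toLinearMap := one_le_cbNorm φ.symm
    have hcd : cbDistortion φ ≤ ENNReal.ofReal (c k) := hdc ▸ hφ.le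
    have hc1 : 1 ≤ c k := by
      have := (one_le_cbDistortion φ).trans hcd
      rwa [ENNReal.one_le_ofReal] at this
    exact ⟨_, fun _ => ⟨⟨τ, rfl⟩, gram_estimate_of_algEquiv hX (hY k) hτ hτ' hc1
      ((le_mul_of_one_le_right' h2).trans hcd) ((le_mul_of_one_le_left' h1).trans hcd)
      ⟨x₀, hx₀⟩⟩⟩
  choose b hb using hex
  have hfin : ∀ᶠ k in atTop, d k < ∞ := hd.eventually (Iio_mem_nhds ENNReal.one_lt_top)
  have hgram : ∀ y x, Tendsto (fun k => (inner ℂ (b k y : HilbertCd ι) (b k x : HilbertCd ι) : ℂ))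
      atTop (𝓝 (inner ℂ (a y : HilbertCd ι) (a x : HilbertCd ι))) := fun y x => by
    have h1 : Tendsto (fun k => (c k ^ 2 - (c k ^ 2)⁻¹) *
        (‖(a x : HilbertCd ι)‖ ^ 2 / (1 - ‖(a x : HilbertCd ι)‖ ^ 2) +
          ‖(a y : HilbertCd ι)‖ ^ 2 / (1 - ‖(a y : HilbertCd ι)‖ ^ 2))) atTop (𝓝 0) := by
      have := ((hc.pow 2).sub ((hc.pow 2).inv₀ (by norm_num))).mul_const
        (‖(a x : HilbertCd ι)‖ ^ 2 / (1 - ‖(a x : HilbertCd ι)‖ ^ 2) +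
          ‖(a y : HilbertCd ι)‖ ^ 2 / (1 - ‖(a y : HilbertCd ι)‖ ^ 2))
      simpa using this
    have h2 := squeeze_zero_norm' (hfin.mono fun k hk => (hb k hk).2 x y) h1
    have h3 : Tendsto (fun k => (c k : ℂ) ^ 2 * inner ℂ (a y : HilbertCd ι) (a x : HilbertCd ι))
        atTop (𝓝 (inner ℂ (a y : HilbertCd ι) (a x : HilbertCd ι))) := by
      have := (((Complex.continuous_ofReal.tendsto 1).comp hc).pow 2).mul_const
        (inner ℂ (a y : HilbertCd ι) (a x : HilbertCd ι))
      simpa using this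
    simpa using h3.sub h2
  obtain ⟨U, hU⟩ := exists_unitary_tendsto_of_gram (fun x => (a x : HilbertCd ι))
    (fun k x => (b k x : HilbertCd ι)) hgram Finset.univ
  have hlim : Tendsto (fun k => ∑ x : X, rhoPh (a x) (unitaryBall (U k) (b k x))) atTop (𝓝 0) := by
    rw [← Finset.sum_const_zero (s := (Finset.univ : Finset X))]
    exact tendsto_finsetSum _ fun x _ => tendsto_rhoPh_zero _ (hU x (Finset.mem_univ x))
  refine squeeze_zero' (Eventually.of_forall fun k => rhoSInv_nonneg _ _)
    (hfin.mono fun k hk => ?_) hlim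
  obtain ⟨⟨τ, hτ⟩, -⟩ := hb k hk
  -- The automorphism moves `τ x₀` to the origin, rotates by `U k`, and moves the origin to `x₀`.
  refine rhoSInv_le (((isBiholomorphic_moebius (τ ⟨x₀, hx₀⟩ : UnitBall ι)).trans
    (isBiholomorphic_unitaryBall (U k))).trans (isBiholomorphic_moebius x₀)) τ
    (Finset.sum_nonneg fun x _ => rhoPh_nonneg _ _) fun x => ?_
  rw [← (preservesKernel_moebius x₀).rhoPh_eq, Equiv.trans_apply, moebius_moebius,
    Equiv.trans_apply]
  have hbx : b k x = moebius (τ ⟨x₀, hx₀⟩ : UnitBall ι) (τ x) := by rw [hτ]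
  rw [← hbx]
  exact Finset.single_le_sum (f := fun x => rhoPh (a x) (unitaryBall (U k) (b k x)))
    (fun x _ => rhoPh_nonneg _ _) (Finset.mem_univ x)

end AlgebraToDistance

/-! ### Small distance yields almost isometric RKHS isomorphisms. -/

section DistanceToKernels

variable {ι : Type*}

theorem exists_seq_of_tendsto_rhoSInv {n : ℕ} (hn : n ≠ 0) {X : Set (UnitBall ι)}
    (hX : X.ncard = n) {Y : ℕ → Set (UnitBall ι)} (hY : ∀ k, (Y k).ncard = n)
    (h : Tendsto (fun k => rhoSInv X (Y k)) atTop (𝓝 0)) :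
    ∃ (Φ : ℕ → (UnitBall ι ≃ UnitBall ι)) (τ : ∀ k, X ≃ Y k), (∀ k, IsBiholomorphic (Φ k)) ∧
      ∀ x : X, Tendsto (fun k => rhoPh (x : UnitBall ι) (Φ k (τ k x))) atTop (𝓝 0) := by
  have hXf : X.Finite := Set.finite_of_ncard_ne_zero (hX ▸ hn)
  have := hXf.to_subtype
  have hex : ∀ k, ∃ (Φ : UnitBall ι ≃ UnitBall ι) (τ : X ≃ Y k), IsBiholomorphic Φ ∧
      ∀ x : X, rhoPh (x : UnitBall ι) (Φ (τ x)) ≤ rhoSInv X (Y k) + 1 / ((k : ℝ) + 1) := fun k => by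
    have hYf : (Y k).Finite := Set.finite_of_ncard_ne_zero (hY k ▸ hn)
    have hlt : rhoSInv X (Y k) < rhoSInv X (Y k) + 1 / ((k : ℝ) + 1) :=
      lt_add_of_pos_right _ (by positivity)
    have : Nonempty {Φ : UnitBall ι ≃ UnitBall ι // IsBiholomorphic Φ} :=
      ⟨⟨_, isBiholomorphic_unitaryBall (LinearIsometryEquiv.refl ℂ _)⟩⟩
    obtain ⟨⟨Φ, hΦ⟩, hΦlt⟩ := exists_lt_of_ciInf_lt hlt
    have := (hYf.image Φ).to_subtype
    have : Nonempty (X ≃ (Φ '' Y k : Set (UnitBall ι))) := by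
      refine Finite.card_eq.mp ?_
      rw [Nat.card_coe_set_eq, Nat.card_coe_set_eq, Set.ncard_image_of_injective _ Φ.injective, hX,
        hY]
    obtain ⟨σ, hσ⟩ := exists_lt_of_ciInf_lt hΦlt
    refine ⟨Φ, σ.trans (Φ.image (Y k)).symm, hΦ, fun x => ?_⟩
    have e : Φ ((σ.trans (Φ.image (Y k)).symm) x : Y k) = σ x :=
      congrArg Subtype.val ((Φ.image (Y k)).apply_symm_apply (σ x))
    rw [e]
    exact (le_ciSup (f := fun x : X => rhoPh (x : UnitBall ι) (σ x)) (Set.finite_range _).bddAbove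
      x).trans hσ.le
  choose Φ τ hΦ hτ using hex
  refine ⟨Φ, τ, hΦ, fun x => squeeze_zero (fun k => rhoPh_nonneg _ _) (fun k => hτ k x) ?_⟩
  simpa using h.add tendsto_one_div_add_atTop_nhds_zero_nat

theorem tendsto_norm_sub_of_rhoPh {α : Type*} {l : Filter α} {f g : α → UnitBall ι}
    (h : Tendsto (fun k => rhoPh (f k) (g k)) l (𝓝 0)) :
    Tendsto (fun k => ‖(f k : HilbertCd ι) - g k‖) l (𝓝 0) := by
  refine squeeze_zero (fun k => norm_nonneg _) (fun k => norm_sub_le_rhoPh _ _) ?_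
  have := h.div ((tendsto_const_nhds (x := (1 : ℝ))).sub h) (by simp)
  simpa [Pi.div_def] using this

theorem tendsto_norm_kerAt_sub {α : Type*} {l : Filter α} {f : α → UnitBall ι} {x : UnitBall ι}
    (h : Tendsto (fun k => (f k : HilbertCd ι)) l (𝓝 x)) :
    Tendsto (fun k => ‖kerAt (DruryArveson ι) (f k) - kerAt (DruryArveson ι) x‖) l (𝓝 0) := by
  have h0 := UnitBall.one_sub_inner_ne_zero x x
  have hc : Tendsto (fun _ : α => (x : HilbertCd ι)) l (𝓝 x) := tendsto_const_nhds
  have e : ∀ {p q : α → HilbertCd ι}, Tendsto p l (𝓝 x) → Tendsto q l (𝓝 x) →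
      Tendsto (fun k => (1 - inner ℂ (p k) (q k) : ℂ)⁻¹) l
        (𝓝 (1 - inner ℂ (x : HilbertCd ι) (x : HilbertCd ι) : ℂ)⁻¹) := fun hp hq =>
    (tendsto_const_nhds.sub (hp.inner hq)).inv₀ h0
  have h1 : Tendsto (fun k => (inner ℂ (kerAt (DruryArveson ι) (f k) - kerAt (DruryArveson ι) x)
      (kerAt (DruryArveson ι) (f k) - kerAt (DruryArveson ι) x) : ℂ)) l (𝓝 0) := by
    simp only [inner_sub_left, inner_sub_right, inner_kerAt_kerAt]
    simpa using ((e h h).sub (e h hc)).sub ((e hc h).sub (e hc hc))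
  simp only [inner_self_eq_norm_sq_to_K, Complex.coe_algebraMap] at h1
  have h2 := h1.norm.sqrt
  simpa [Real.sqrt_sq (norm_nonneg _)] using h2

/-- An interpolating multiplier applied to the constant `1` is a function that isolates one
coefficient of a relation. -/
theorem linearIndependent_kerAt :
    LinearIndependent ℂ (fun x : UnitBall ι => kerAt (DruryArveson ι) x) := by
  rw [linearIndependent_iff']
  intro s g hg x hx
  obtain ⟨δ, hδ, hδ2, hS⟩ := exists_separation s
  obtain ⟨p, ⟨M, hM, -⟩, hp1, hp0⟩ := (preservesKernel_id (ι := ι)).exists_interpolating s x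
    hδ hδ2 (hS x hx)
  have h0 : ∀ z, kerAt (DruryArveson ι) (⟨0, by simp⟩ : UnitBall ι) z = 1 := fun z => by
    rw [kerAt_druryArveson_apply]; simp
  have h1 := congrArg (fun h => inner ℂ (M (kerAt (DruryArveson ι) ⟨0, by simp⟩)) h) hg
  simp only [inner_sum, inner_smul_right, inner_zero_right] at h1
  rw [Finset.sum_eq_single x] at h1
  · rw [← inner_conj_symm, inner_kerAt, hM, h0, hp1 x rfl] at h1
    simpa using h1
  · intro y hy hyx
    rw [← inner_conj_symm, inner_kerAt, hM, h0, hp0 y hy hyx y rfl]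
    simp
  · exact fun h => absurd hx h

/-- The basis of kernel functions of `H_X`, for finite `X`. -/
def kernelBasis {X : Set (UnitBall ι)} (hX : X.Finite) : Module.Basis X ℂ (daQuotient X) :=
  Module.Basis.mk (v := fun x : X => kerAt (daQuotient X) x)
    (by
      refine LinearIndependent.of_comp (daQuotient X).subtype ?_
      have h := linearIndependent_kerAt.comp (fun x : X => (x : UnitBall ι))
        Subtype.val_injective
      convert h using 1
      exact funext coe_kerAt_daQuotient)
    (by
      have := hX.to_subtype
      have hfin : FiniteDimensional ℂ
          (Submodule.span ℂ (Set.range fun x : X => kerAt (daQuotient X) x)) :=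
        FiniteDimensional.span_of_finite ℂ (Set.finite_range _)
      rw [top_le_iff, ← Submodule.orthogonal_eq_bot_iff, Submodule.eq_bot_iff]
      intro h hh
      refine RKHS.ext fun x => ?_
      rw [← inner_kerAt, RKHS.coe_zero, Pi.zero_apply]
      exact (Submodule.mem_orthogonal _ _).mp hh _ (Submodule.subset_span ⟨x, rfl⟩))

theorem kernelBasis_apply {X : Set (UnitBall ι)} (hX : X.Finite) (x : X) :
    kernelBasis hX x = kerAt (daQuotient X) x :=
  Module.Basis.mk_apply _ _ _

theorem norm_sum_smul_eq_of_gram {α E F : Type*} [Fintype α] [NormedAddCommGroup E]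
    [InnerProductSpace ℂ E] [NormedAddCommGroup F] [InnerProductSpace ℂ F] {p : α → E} {q : α → F}
    (h : ∀ i j, (inner ℂ (p i) (p j) : ℂ) = inner ℂ (q i) (q j)) (v : α → ℂ) :
    ‖∑ i, v i • p i‖ = ‖∑ i, v i • q i‖ := by
  have : (inner ℂ (∑ i, v i • p i) (∑ i, v i • p i) : ℂ) =
      inner ℂ (∑ i, v i • q i) (∑ i, v i • q i) := by
    simp only [sum_inner, inner_sum, inner_smul_left, inner_smul_right, h]
  simp only [inner_self_eq_norm_sq_to_K, Complex.coe_algebraMap] at this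
  refine (sq_eq_sq₀ (norm_nonneg _) (norm_nonneg _)).mp ?_
  exact_mod_cast this

/-- Up to an isometry, `T` replaces `k_x` by `k_{Φ(τ x)}` in `∑ v_x k_x`. Since `|v_x| ≤ ‖e x‖ ‖h‖`,
this changes the vector `h` by at most `η ‖h‖`. -/
theorem deltaRK_le {X Y : Set (UnitBall ι)} (hX : X.Finite) (hY : Y.Finite) [Fintype X]
    {Φ : UnitBall ι → UnitBall ι} (hΦ : PreservesKernel Φ) (τ : X ≃ Y) {e : X → daQuotient X}
    (he1 : ∀ x, e x x = 1) (he0 : ∀ x y, y ≠ x → e x y = 0) {η : ℝ} (hη : η < 1)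
    (hηe : ∑ x, ‖e x‖ *
      ‖kerAt (DruryArveson ι) (Φ (τ x)) - kerAt (DruryArveson ι) (x : UnitBall ι)‖ ≤ η) :
    deltaRK (daQuotient X) (daQuotient Y) ≤ ENNReal.ofReal ((1 + η) / (1 - η)) := by
  obtain ⟨g, hg0, hg⟩ := hΦ.exists_ne_zero
  have hη0 : 0 ≤ η :=
    (Finset.sum_nonneg fun x _ => mul_nonneg (norm_nonneg _) (norm_nonneg _)).trans hηe
  -- With this weight the vectors `c x • k_{τ x}` have the same Gram matrix as the `k_{Φ(τ x)}`.
  let c : X → ℂ := fun x => (conj (g (τ x)))⁻¹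
  have hc : ∀ x, c x ≠ 0 := fun x => inv_ne_zero ((map_ne_zero (starRingEnd ℂ)).mpr (hg0 _))
  let b := kernelBasis hX
  let b' := ((kernelBasis hY).reindex τ.symm).isUnitSMul fun x => (hc x).isUnit
  have hb' : ∀ x, b' x = c x • kerAt (daQuotient Y) (τ x) := fun x => by
    simp [b', Module.Basis.isUnitSMul_apply, kernelBasis_apply]
  let T₀ := b.equiv b' (Equiv.refl X)
  have : FiniteDimensional ℂ (daQuotient X) := b.finiteDimensional_of_finite
  let T := T₀.toContinuousLinearEquiv
  have hTb : ∀ x, T (kerAt (daQuotient X) x) = c x • kerAt (daQuotient Y) (τ x) := fun x => by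
    rw [← hb', ← kernelBasis_apply hX]
    exact b.equiv_apply x b' (Equiv.refl X)
  have hcoord : ∀ (v : X → ℂ) (x : X),
      inner ℂ (e x) (∑ y, v y • kerAt (daQuotient X) y) = v x := fun v x => by
    rw [inner_sum, Finset.sum_eq_single x]
    · rw [inner_smul_right, ← inner_conj_symm, inner_kerAt, he1, map_one, mul_one]
    · intro y _ hy
      rw [inner_smul_right, ← inner_conj_symm, inner_kerAt, he0 x y hy, map_zero, mul_zero]
    · simp
  have hest : ∀ h : daQuotient X, |‖T h‖ - ‖h‖| ≤ η * ‖h‖ := fun h => by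
    obtain ⟨v, rfl⟩ : ∃ v : X → ℂ, h = ∑ x, v x • kerAt (daQuotient X) x :=
      ⟨b.repr h, by
        conv_lhs => rw [← b.sum_repr h]
        simp [b, kernelBasis_apply]⟩
    have h1 : ‖T (∑ x, v x • kerAt (daQuotient X) x)‖ =
        ‖∑ x, v x • kerAt (DruryArveson ι) (Φ (τ x))‖ := by
      simp only [map_sum, map_smul, hTb]
      refine norm_sum_smul_eq_of_gram (fun x y => ?_) v
      rw [inner_smul_left, inner_smul_right, inner_kerAt_daQuotient, inner_kerAt_kerAt, hg]
      simp only [c, map_inv₀, Complex.conj_conj, mul_inv]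
      ring
    have h2 : ‖∑ x, v x • kerAt (daQuotient X) x‖ =
        ‖∑ x : X, v x • kerAt (DruryArveson ι) (x : UnitBall ι)‖ :=
      norm_sum_smul_eq_of_gram
        (fun x y => by rw [inner_kerAt_daQuotient, inner_kerAt_kerAt]) v
    have h3 : ‖∑ x, v x • kerAt (DruryArveson ι) (Φ (τ x)) -
        ∑ x : X, v x • kerAt (DruryArveson ι) (x : UnitBall ι)‖ ≤
        η * ‖∑ x, v x • kerAt (daQuotient X) x‖ := by
      rw [← Finset.sum_sub_distrib]
      refine (norm_sum_le _ _).trans (le_trans ?_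
        (mul_le_mul_of_nonneg_right hηe (norm_nonneg _)))
      rw [Finset.sum_mul]
      refine Finset.sum_le_sum fun x _ => ?_
      rw [← smul_sub, norm_smul]
      have h4 := norm_inner_le_norm (𝕜 := ℂ) (e x) (∑ y, v y • kerAt (daQuotient X) y)
      rw [hcoord] at h4
      rw [mul_right_comm]
      gcongr
    calc _ ≤ _ := by rw [h1, h2]; exact abs_norm_sub_norm_le _ _
      _ ≤ _ := h3
  have hT1 : ‖(T : daQuotient X →L[ℂ] daQuotient Y)‖ ≤ 1 + η :=
    ContinuousLinearMap.opNorm_le_bound _ (by positivity) fun h => by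
      have := (abs_le.mp (hest h)).2
      rw [ContinuousLinearEquiv.coe_coe]
      linarith
  have hT2 : ‖(T.symm : daQuotient Y →L[ℂ] daQuotient X)‖ ≤ (1 - η)⁻¹ :=
    ContinuousLinearMap.opNorm_le_bound _ (inv_nonneg.mpr (by linarith)) fun h => by
      have := (abs_le.mp (hest (T.symm h))).1
      rw [ContinuousLinearEquiv.apply_symm_apply] at this
      rw [ContinuousLinearEquiv.coe_coe, inv_mul_eq_div, le_div_iff₀ (by linarith)]
      linarith
  refine (iInf₂_le T ⟨τ, c, hc, hTb⟩).trans ?_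
  rw [← ofReal_norm, ← ofReal_norm, ← ENNReal.ofReal_mul (norm_nonneg _), div_eq_mul_inv]
  exact ENNReal.ofReal_le_ofReal (mul_le_mul hT1 hT2 (norm_nonneg _) (by positivity))

theorem tendsto_deltaRK_of_rhoSInv {n : ℕ} (hn : n ≠ 0) {X : Set (UnitBall ι)}
    (hX : X.ncard = n) {Y : ℕ → Set (UnitBall ι)} (hY : ∀ k, (Y k).ncard = n)
    (h : Tendsto (fun k => rhoSInv X (Y k)) atTop (𝓝 0)) :
    Tendsto (fun k => deltaRK (daQuotient X) (daQuotient (Y k))) atTop (𝓝 1) := by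
  have hXf : X.Finite := Set.finite_of_ncard_ne_zero (hX ▸ hn)
  have := hXf.fintype
  have : Nontrivial (daQuotient X) :=
    nontrivial_daQuotient (Set.nonempty_of_ncard_ne_zero (hX ▸ hn))
  obtain ⟨Φ, τ, hΦ, hτ⟩ := exists_seq_of_tendsto_rhoSInv hn hX hY h
  choose e he1 he0 using exists_interpolating_daQuotient hXf
  let η : ℕ → ℝ := fun k => ∑ x, ‖e x‖ *
    ‖kerAt (DruryArveson ι) (Φ k (τ k x)) - kerAt (DruryArveson ι) (x : UnitBall ι)‖
  have hη : Tendsto η atTop (𝓝 0) := by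
    have : (0 : ℝ) = ∑ x, ‖e x‖ * 0 := by simp
    rw [this]
    refine tendsto_finsetSum _ fun x _ => (tendsto_norm_kerAt_sub ?_).const_mul _
    refine tendsto_iff_norm_sub_tendsto_zero.mpr ((tendsto_norm_sub_of_rhoPh (hτ x)).congr
      fun k => ?_)
    exact norm_sub_rev _ _
  have hlim : Tendsto (fun k => ENNReal.ofReal ((1 + η k) / (1 - η k))) atTop (𝓝 1) := by
    rw [← ENNReal.ofReal_one]
    refine (ENNReal.continuous_ofReal.tendsto _).comp ?_
    have := ((tendsto_const_nhds (x := (1 : ℝ))).add hη).div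
      ((tendsto_const_nhds (x := (1 : ℝ))).sub hη) (by simp)
    simpa [Pi.div_def] using this
  refine tendsto_of_tendsto_of_tendsto_of_le_of_le' tendsto_const_nhds hlim
    (Eventually.of_forall fun k => one_le_deltaRK) ?_
  filter_upwards [hη.eventually (Iio_mem_nhds one_pos)] with k hk
  exact deltaRK_le hXf (Set.finite_of_ncard_ne_zero (hY k ▸ hn)) (hΦ k).preservesKernel (τ k)
    he1 he0 hk le_rfl

end DistanceToKernels

/-! ### The multiplier discrepancy. -/

section MultiplierDiscrepancy

variable {ι : Type*}

theorem rowMultNorm_le {F : UnitBall ι → HilbertCd ι} {C : ℝ}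
    (h : ∃ M, IsRowMultOp F M ∧ ‖M‖ ≤ C) : rowMultNorm F ≤ ENNReal.ofReal C := by
  obtain ⟨M, hM, hC⟩ := h
  refine (iInf₂_le M hM).trans ?_
  rw [← ofReal_norm]
  exact ENNReal.ofReal_le_ofReal hC

/-- `F = Φ + ∑ p_i w_i` with interpolating multipliers `p_i`. Their norms depend only on `δ` and the
number of points, so the total norm tends to `1` as the corrections `w_i` tend to zero. -/
theorem exists_isRowMultOp_perturbation {Φ Ψ : UnitBall ι → UnitBall ι} (hΦ : PreservesKernel Φ)
    (hΨ : PreservesKernel Ψ) {α : Type*} [Fintype α] (q : α → UnitBall ι) {δ : ℝ} (hδ : 0 < δ)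
    (hδ2 : δ ≤ 2) (hq : ∀ i j, i ≠ j → δ ≤ ‖(q i : HilbertCd ι) - q j‖) (w : α → HilbertCd ι) :
    ∃ F : UnitBall ι → HilbertCd ι,
      (∃ M, IsRowMultOp F M ∧ ‖M‖ ≤ 1 + ∑ i, (2 / δ) ^ Fintype.card α * ‖w i‖) ∧
      ∀ i z, Ψ z = q i → F z = Φ z + w i := by
  classical
  obtain ⟨M₀, hM₀, hM₀1⟩ := hΦ.exists_isRowMultOp
  have hp : ∀ i, ∃ p : UnitBall ι → ℂ, IsMultiplierOfBound p ((2 / δ) ^ Fintype.card α) ∧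
      ∀ z, (Ψ z = q i → p z = 1) ∧ ∀ j, j ≠ i → Ψ z = q j → p z = 0 := fun i => by
    obtain ⟨p, hp, hp1, hp0⟩ := hΨ.exists_interpolating (Finset.univ.image q) (q i) hδ hδ2
      (fun y hy hyi => by
        obtain ⟨j, -, rfl⟩ := Finset.mem_image.mp hy
        exact hq i j fun h => hyi (h ▸ rfl))
    refine ⟨p, hp.mono (pow_le_pow_right₀ ((one_le_div hδ).mpr hδ2) Finset.card_image_le),
      fun z => ⟨hp1 z, fun j hj hz => hp0 (q j) (Finset.mem_image_of_mem _ (Finset.mem_univ j))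
        (fun h => ?_) z hz⟩⟩
    have := hq j i hj
    rw [h, sub_self, norm_zero] at this
    exact absurd this (not_le.mpr hδ)
  choose p hp hp01 using hp
  choose N hN hNC using fun i => (hp i).exists_isRowMultOp (w i)
  have hsum : ∀ s : Finset α, ∃ M, IsRowMultOp (fun z => ∑ i ∈ s, p i z • w i) M ∧
      ‖M‖ ≤ ∑ i ∈ s, (2 / δ) ^ Fintype.card α * ‖w i‖ := fun s => by
    induction s using Finset.induction_on with
    | empty => exact ⟨0, by simpa using isRowMultOp_zero,
      ContinuousLinearMap.opNorm_zero.le.trans (by simp)⟩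
    | insert i s hi ih =>
      obtain ⟨M, hM, hMC⟩ := ih
      simp only [Finset.sum_insert hi]
      exact ⟨N i + M, (hN i).add hM,
        (ContinuousLinearMap.opNorm_add_le _ _).trans (add_le_add (hNC i) hMC)⟩
  obtain ⟨M, hM, hMC⟩ := hsum Finset.univ
  refine ⟨fun z => Φ z + ∑ i, p i z • w i, ⟨M₀ + M, hM₀.add hM,
    (ContinuousLinearMap.opNorm_add_le _ _).trans (add_le_add hM₀1 hMC)⟩, fun i z hz => ?_⟩
  simp only
  rw [Finset.sum_eq_single i, (hp01 i z).1 hz, one_smul]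
  · intro j _ hj
    rw [(hp01 j z).2 i hj.symm hz, zero_smul]
  · simp

theorem tendsto_deltaMult_upper {n : ℕ} (hn : n ≠ 0) {X : Set (UnitBall ι)}
    (hX : X.ncard = n) {Y : ℕ → Set (UnitBall ι)} (hY : ∀ k, (Y k).ncard = n)
    (h : Tendsto (fun k => rhoSInv X (Y k)) atTop (𝓝 0)) :
    ∃ u : ℕ → ℝ≥0∞, Tendsto u atTop (𝓝 1) ∧ ∀ᶠ k in atTop, deltaMult X (Y k) ≤ u k := by
  have hXf : X.Finite := Set.finite_of_ncard_ne_zero (hX ▸ hn)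
  have := hXf.fintype
  obtain ⟨Φ, τ, hΦ, hτ⟩ := exists_seq_of_tendsto_rhoSInv hn hX hY h
  obtain ⟨δ, hδ, hδ2, hS⟩ := exists_separation hXf.toFinset
  have hsep : ∀ x y : X, x ≠ y → δ ≤ ‖((x : UnitBall ι) : HilbertCd ι) - (y : UnitBall ι)‖ :=
    fun x y hxy => hS x (by simp) y (by simp) fun h => hxy (Subtype.ext h.symm)
  let w : ∀ k, X → HilbertCd ι := fun k x => (τ k x : UnitBall ι) - (Φ k).symm x
  let w' : ∀ k, X → HilbertCd ι := fun k x => (x : UnitBall ι) - Φ k (τ k x)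
  have hw : ∀ x, Tendsto (fun k => ‖w k x‖) atTop (𝓝 0) := fun x => by
    refine tendsto_norm_sub_of_rhoPh ((hτ x).congr fun k => ?_)
    rw [rhoPh_comm, ← (hΦ k).preservesKernel.symm.rhoPh_eq, Equiv.symm_apply_apply]
  have hw' : ∀ x, Tendsto (fun k => ‖w' k x‖) atTop (𝓝 0) := fun x =>
    tendsto_norm_sub_of_rhoPh (hτ x)
  -- The separation is halved because the points `Φ k (τ k x)` are only within `δ / 4` of the points
  -- `x`.
  let C : ℝ := (2 / (δ / 2)) ^ Fintype.card X
  let u : ℕ → ℝ := fun k => 1 + ∑ x, C * ‖w k x‖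
  let u' : ℕ → ℝ := fun k => 1 + ∑ x, C * ‖w' k x‖
  have hlim : ∀ v : ℕ → X → HilbertCd ι, (∀ x, Tendsto (fun k => ‖v k x‖) atTop (𝓝 0)) →
      Tendsto (fun k => ENNReal.ofReal (1 + ∑ x, C * ‖v k x‖)) atTop (𝓝 1) := fun v hv => by
    rw [← ENNReal.ofReal_one]
    refine (ENNReal.continuous_ofReal.tendsto _).comp ?_
    have := (tendsto_const_nhds (x := (1 : ℝ))).add
      (tendsto_finsetSum (Finset.univ : Finset X) fun x _ => (hv x).const_mul C)
    simpa using this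
  refine ⟨fun k => max (ENNReal.ofReal (u k)) (ENNReal.ofReal (u' k)), ?_, ?_⟩
  · simpa using (hlim w hw).max (hlim w' hw')
  have hsmall : ∀ᶠ k in atTop, ∀ x, ‖w' k x‖ < δ / 4 :=
    eventually_all.mpr fun x => (hw' x).eventually (Iio_mem_nhds (by positivity))
  filter_upwards [hsmall] with k hk
  have hδ' : 0 < δ / 2 := by positivity
  obtain ⟨F, hF, hFx⟩ := exists_isRowMultOp_perturbation (hΦ k).preservesKernel.symm
    (preservesKernel_id (ι := ι)) (fun x : X => (x : UnitBall ι)) hδ' (by linarith)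
    (fun x y hxy => (by linarith : δ / 2 ≤ δ).trans (hsep x y hxy)) (w k)
  -- Interpolation on `Y k` is carried out through the coordinates of `Φ k`: the points of `Y k`
  -- themselves may cluster near the sphere, but their images stay separated.
  obtain ⟨G, hG, hGx⟩ := exists_isRowMultOp_perturbation (hΦ k).preservesKernel
    (hΦ k).preservesKernel (fun x : X => Φ k (τ k x)) hδ' (by linarith)
    (fun x y hxy => by
      have h1 := hsep x y hxy
      have h2 : ((x : UnitBall ι) : HilbertCd ι) - (y : UnitBall ι) =
          ((Φ k (τ k x) : HilbertCd ι) - Φ k (τ k y)) + (w' k x - w' k y) := by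
        simp only [w']; abel
      have h3 := norm_add_le ((Φ k (τ k x) : HilbertCd ι) - Φ k (τ k y)) (w' k x - w' k y)
      have h4 := norm_sub_le (w' k x) (w' k y)
      rw [← h2] at h3
      linarith [hk x, hk y]) (w' k)
  refine iInf_le_of_le F <| iInf_le_of_le G <| iInf_le_of_le ⟨τ k, fun x => ?_, fun y => ?_⟩ <|
    max_le_max (rowMultNorm_le hF) (rowMultNorm_le hG)
  · rw [hFx x x rfl]
    exact add_sub_cancel _ _
  · rw [hGx ((τ k).symm y) y (by simp)]
    simp [w']

/-- A Schwarz–Pick lemma: strict contractivity makes the `2 × 2` matrix with entries `(1 - ⟨F z, F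
w⟩) / (1 - ⟨z, w⟩)` positive definite, and positivity of its determinant is the claim, by
`one_sub_rhoPh_sq`. -/
theorem IsRowMultOp.rhoPh_lt {F : UnitBall ι → HilbertCd ι}
    {M : lp (fun _ : ι => DruryArveson ι) 2 →L[ℂ] DruryArveson ι} (hM : IsRowMultOp F M)
    (hM1 : ‖M‖ < 1) {x x' y y' : UnitBall ι} (hx : x ≠ x') (hy : F x = y) (hy' : F x' = y') :
    rhoPh y y' < rhoPh x x' := by
  let D : UnitBall ι → UnitBall ι → ℂ := fun z w => 1 - inner ℂ (w : HilbertCd ι) (z : HilbertCd ι)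
  have hD : ∀ z w, D z w ≠ 0 := fun z w => UnitBall.one_sub_inner_ne_zero w z
  have hform : ∀ s t : ℂ, s ≠ 0 ∨ t ≠ 0 →
      0 < (conj s * s * (D y y / D x x) + conj s * t * (D y y' / D x x') +
        conj t * s * (D y' y / D x' x) + conj t * t * (D y' y' / D x' x')).re := by
    intro s t hst
    let k := kerAt (DruryArveson ι) x
    let k' := kerAt (DruryArveson ι) x'
    let h := s • k + t • k'
    have hh : h ≠ 0 := fun h0 => by
      have hinj : Function.Injective ![x, x'] := by
        intro i j hij
        fin_cases i <;> fin_cases j <;> simp_all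
      have hpair := (linearIndependent_kerAt (ι := ι)).comp _ hinj
      have e : (fun z => kerAt (DruryArveson ι) z) ∘ ![x, x'] = ![k, k'] := by
        ext i : 1; fin_cases i <;> rfl
      rw [e] at hpair
      have hli := LinearIndependent.pair_iff.mp hpair s t h0
      exact hst.elim (fun h => h hli.1) fun h => h hli.2
    have hadj : ContinuousLinearMap.adjoint M h =
        s • elemTensor (star (y : HilbertCd ι)) k + t • elemTensor (star (y' : HilbertCd ι)) k' := by
      rw [map_add, map_smul, map_smul, hM.adjoint_kerAt, hM.adjoint_kerAt, hy, hy']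
    have hlt : ‖ContinuousLinearMap.adjoint M h‖ ^ 2 < ‖h‖ ^ 2 := by
      have h1 : ‖ContinuousLinearMap.adjoint M‖ < 1 := by rwa [LinearIsometryEquiv.norm_map]
      have h2 := (ContinuousLinearMap.adjoint M).le_opNorm h
      have h3 := norm_pos_iff.mpr hh
      have h4 : ‖ContinuousLinearMap.adjoint M h‖ < ‖h‖ := by nlinarith
      gcongr
    have e : (inner ℂ h h - inner ℂ (ContinuousLinearMap.adjoint M h)
        (ContinuousLinearMap.adjoint M h) : ℂ) =
        conj s * s * (D y y / D x x) + conj s * t * (D y y' / D x x') +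
        conj t * s * (D y' y / D x' x) + conj t * t * (D y' y' / D x' x') := by
      rw [hadj]
      simp only [h, k, k', inner_add_left, inner_add_right, inner_smul_left, inner_smul_right,
        inner_elemTensor, inner_star_star, inner_kerAt_kerAt, D, div_eq_mul_inv]
      ring
    rw [← e, inner_self_eq_norm_sq_to_K, inner_self_eq_norm_sq_to_K]
    simp only [Complex.coe_algebraMap]
    rw [← Complex.ofReal_pow, ← Complex.ofReal_pow, ← Complex.ofReal_sub, Complex.ofReal_re]
    linarith
  have hDd : ∀ z, D z z = ((1 - ‖(z : HilbertCd ι)‖ ^ 2 : ℝ) : ℂ) := fun z => by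
    simp only [D, inner_self_eq_norm_sq_to_K, Complex.coe_algebraMap]
    push_cast
    rfl
  have hDc : ∀ z w, D w z = conj (D z w) := fun z w => by
    simp only [D, map_sub, map_one, inner_conj_symm]
  have hpos : ∀ z : UnitBall ι, 0 < 1 - ‖(z : HilbertCd ι)‖ ^ 2 := fun z => by
    nlinarith [norm_nonneg (z : HilbertCd ι), mem_ball_zero_iff.mp z.2]
  let m₁ : ℝ := (1 - ‖(y : HilbertCd ι)‖ ^ 2) / (1 - ‖(x : HilbertCd ι)‖ ^ 2)
  let m₂ : ℝ := (1 - ‖(y' : HilbertCd ι)‖ ^ 2) / (1 - ‖(x' : HilbertCd ι)‖ ^ 2)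
  let m : ℂ := D y y' / D x x'
  have hm₁ : D y y / D x x = (m₁ : ℂ) := by rw [hDd, hDd, ← Complex.ofReal_div]
  have hm₂ : D y' y' / D x' x' = (m₂ : ℂ) := by rw [hDd, hDd, ← Complex.ofReal_div]
  have hm : D y' y / D x' x = conj m := by rw [hDc y y', hDc x x', map_div₀]
  have hm₁0 : 0 < m₁ := div_pos (hpos y) (hpos x)
  have hdet : ‖m‖ ^ 2 < m₁ * m₂ := by
    -- At this vector the form equals `m₁` times the determinant.
    have h1 := hform (-m) m₁ (Or.inr (by exact_mod_cast hm₁0.ne'))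
    rw [hm₁, hm₂, hm] at h1
    have e : (conj (-m) * -m * (m₁ : ℂ) + conj (-m) * m₁ * m + conj (m₁ : ℂ) * -m * conj m +
        conj (m₁ : ℂ) * m₁ * m₂) = ((m₁ * (m₁ * m₂ - ‖m‖ ^ 2) : ℝ) : ℂ) := by
      push_cast
      rw [← Complex.conj_mul', map_neg, Complex.conj_ofReal]
      ring
    rw [show D y y' / D x x' = m from rfl, e, Complex.ofReal_re] at h1
    have := pos_of_mul_pos_right h1 hm₁0.le
    linarith
  have h1 := one_sub_rhoPh_sq x x'
  have h2 := one_sub_rhoPh_sq y y'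
  have hD1 := norm_pos_iff.mpr (hD x x')
  have hD2 := norm_pos_iff.mpr (hD y y')
  have hlt : 1 - rhoPh x x' ^ 2 < 1 - rhoPh y y' ^ 2 := by
    rw [h1, h2]
    have p1 := hpos x
    have p2 := hpos x'
    rw [div_lt_div_iff₀ (by positivity) (by positivity)]
    simp only [m, m₁, m₂, norm_div, div_pow] at hdet
    rw [div_mul_div_comm, div_lt_div_iff₀ (by positivity) (by positivity)] at hdet
    simp only [D] at hdet
    linarith
  exact lt_of_pow_lt_pow_left₀ 2 (rhoPh_nonneg _ _) (by linarith)

theorem exists_isRowMultOp_of_rowMultNorm_lt {F : UnitBall ι → HilbertCd ι}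
    (h : rowMultNorm F < 1) : ∃ M, IsRowMultOp F M ∧ ‖M‖ < 1 := by
  obtain ⟨M, hM⟩ := iInf_lt_iff.mp h
  obtain ⟨hMF, hM1⟩ := iInf_lt_iff.mp hM
  rw [← ofReal_norm, ENNReal.ofReal_lt_one] at hM1
  exact ⟨M, hMF, hM1⟩

/-- If both norms were below one, `F` and then `G` would strictly decrease the distance of two
points of `X` and yet return them to themselves. -/
theorem one_le_deltaMult {X Y : Set (UnitBall ι)} (hX : X.Nontrivial) : 1 ≤ deltaMult X Y := by
  refine le_iInf fun F => le_iInf fun G => le_iInf fun ⟨σ, hF, hG⟩ => ?_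
  by_contra! hlt
  obtain ⟨M, hM, hM1⟩ := exists_isRowMultOp_of_rowMultNorm_lt ((le_max_left _ _).trans_lt hlt)
  obtain ⟨N, hN, hN1⟩ := exists_isRowMultOp_of_rowMultNorm_lt ((le_max_right _ _).trans_lt hlt)
  obtain ⟨x, hx, x', hx', hne⟩ := hX
  have h1 := hM.rhoPh_lt hM1 hne (hF ⟨x, hx⟩) (hF ⟨x', hx'⟩)
  have h2 := hN.rhoPh_lt hN1 (x := σ ⟨x, hx⟩) (x' := σ ⟨x', hx'⟩)
    (fun h => hne (by simpa using σ.injective (Subtype.ext h))) (hG _) (hG _)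
  rw [σ.symm_apply_apply, σ.symm_apply_apply] at h2
  exact lt_asymm h1 h2

theorem tendsto_deltaMult_of_rhoSInv {n : ℕ} (hn : 2 ≤ n) {X : Set (UnitBall ι)}
    (hX : X.ncard = n) {Y : ℕ → Set (UnitBall ι)} (hY : ∀ k, (Y k).ncard = n)
    (h : Tendsto (fun k => rhoSInv X (Y k)) atTop (𝓝 0)) :
    Tendsto (fun k => deltaMult X (Y k)) atTop (𝓝 1) := by
  obtain ⟨u, hu, hle⟩ := tendsto_deltaMult_upper (by omega) hX hY h
  have hX2 : X.Nontrivial := Set.one_lt_ncard_iff_nontrivial_and_finite.mp (by omega) |>.1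
  exact tendsto_of_tendsto_of_tendsto_of_le_of_le' tendsto_const_nhds hu
    (Eventually.of_forall fun k => one_le_deltaMult hX2) hle

end MultiplierDiscrepancy

theorem tendsto_log_nhds_zero_iff {α : Type*} {l : Filter α} {f : α → ℝ≥0∞} :
    Tendsto (fun k => ENNReal.log (f k)) l (𝓝 0) ↔ Tendsto f l (𝓝 1) := by
  rw [← ENNReal.log_one]
  exact (ENNReal.logHomeomorph.isInducing.tendsto_nhds_iff (f := f) (y := 1)).symm

end

theorem theorem5p4 {ι : Type*} [Countable ι] (n : ℕ) (hn : 2 ≤ n)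
    (X : Set (UnitBall ι)) (hX : X.ncard = n)
    (Y : ℕ → Set (UnitBall ι)) (hY : ∀ k, (Y k).ncard = n) :
    List.TFAE [
      Tendsto (fun k => rhoSInv X (Y k)) atTop (𝓝 0),
      Tendsto (fun k => rhoRK (daQuotient X) (daQuotient (Y k))) atTop (𝓝 0),
      Tendsto (fun k => rhoM (daQuotient X) (daQuotient (Y k))) atTop (𝓝 0),
      Tendsto (fun k => deltaAlg (daQuotient X) (daQuotient (Y k))) atTop (𝓝 1)] ∧
    (Tendsto (fun k => rhoM (daQuotient X) (daQuotient (Y k))) atTop (𝓝 0) →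
      Tendsto (fun k => deltaMult X (Y k)) atTop (𝓝 1)) := by
  have hn0 : n ≠ 0 := by omega
  have hXf : X.Finite := Set.finite_of_ncard_ne_zero (hX ▸ hn0)
  have hXn : X.Nonempty := Set.nonempty_of_ncard_ne_zero (hX ▸ hn0)
  have hYf : ∀ k, (Y k).Finite := fun k => Set.finite_of_ncard_ne_zero (hY k ▸ hn0)
  have hYn : ∀ k, (Y k).Nonempty := fun k => Set.nonempty_of_ncard_ne_zero (hY k ▸ hn0)
  have : Nontrivial (daQuotient X) := nontrivial_daQuotient hXn
  have : ∀ k, Nontrivial (daQuotient (Y k)) := fun k => nontrivial_daQuotient (hYn k)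
  have h12 : Tendsto (fun k => rhoSInv X (Y k)) atTop (𝓝 0) →
      Tendsto (fun k => rhoRK (daQuotient X) (daQuotient (Y k))) atTop (𝓝 0) := fun h =>
    tendsto_log_nhds_zero_iff.mpr (tendsto_deltaRK_of_rhoSInv hn0 hX hY h)
  have h23 : Tendsto (fun k => rhoRK (daQuotient X) (daQuotient (Y k))) atTop (𝓝 0) →
      Tendsto (fun k => rhoM (daQuotient X) (daQuotient (Y k))) atTop (𝓝 0) := fun h => by
    refine tendsto_log_nhds_zero_iff.mpr ?_
    have h1 := ENNReal.Tendsto.pow (n := 2) (tendsto_log_nhds_zero_iff.mp h)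
    rw [one_pow] at h1
    exact tendsto_of_tendsto_of_tendsto_of_le_of_le tendsto_const_nhds h1
      (fun k => one_le_deltaAlg.trans deltaAlg_le_deltaM) fun k => deltaM_le_deltaRK_sq
  have h34 : Tendsto (fun k => rhoM (daQuotient X) (daQuotient (Y k))) atTop (𝓝 0) →
      Tendsto (fun k => deltaAlg (daQuotient X) (daQuotient (Y k))) atTop (𝓝 1) := fun h =>
    tendsto_of_tendsto_of_tendsto_of_le_of_le tendsto_const_nhds
      (tendsto_log_nhds_zero_iff.mp h) (fun k => one_le_deltaAlg) fun k => deltaAlg_le_deltaM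
  have h41 : Tendsto (fun k => deltaAlg (daQuotient X) (daQuotient (Y k))) atTop (𝓝 1) →
      Tendsto (fun k => rhoSInv X (Y k)) atTop (𝓝 0) :=
    tendsto_rhoSInv_of_deltaAlg hXf hXn hYf hYn
  refine ⟨?_, fun h => tendsto_deltaMult_of_rhoSInv hn hX hY (h41 (h34 h))⟩
  tfae_have 1 → 2 := h12
  tfae_have 2 → 3 := h23
  tfae_have 3 → 4 := h34
  tfae_have 4 → 1 := h41
  tfae_finish
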